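/- Let $T$ be the right shift on $\ell^2(\mathbb{Z}_+)$, let $T_{n,m}=T^nT^{*m}$ for $n,m\in\mathbb{Z}_+$, let $\mathcal{T}\subset\mathcal{B}(\ell^2(\mathbb{Z}_+))$ be the Toeplitz algebra, i.e. the norm closed subalgebra generated by $T$ and $T^*$, and let $\Delta:\mathcal{T}\to\mathcal{T}\otimes\mathcal{T}$ (minimal $C^*$-tensor product) be the unital $*$-homomorphism with $\Delta(T)=T\otimes T$. Let $\mathcal{T}^*$ be the (commutative) Banach algebra of all continuous linear functionals on $\mathcal{T}$, with the dual norm and the product $(\rho*\varphi)(A)=(\rho\otimes\varphi)(\Delta(A))$. Then: 1. There is a unique continuous linear functional $\epsilon\in\mathcal{T}^*$ with $\epsilon(T_{n,m})=1$ for all $n,m\in\mathbb{Z}_+$. 2. The algebra $\mathcal{K}$ of compact operators on $\ell^2(\mathbb{Z}_+)$ is contained in $\mathcal{T}$, there is an isometric isomorphism $\mathcal{T}/\mathcal{K}\cong C(S^1)$ such that the composition $\gamma:\mathcal{T}\to\mathcal{T}/\mathcal{K}\cong C(S^1)$ (the symbol map) is a unital $*$-homomorphism with $\gamma(T_{n,m})(z)=z^{m-n}$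 for all $n,m\in\mathbb{Z}_+$, $z\in S^1$, and $\epsilon(A)=\gamma(A)(1)$ for all $A\in\mathcal{T}$. 3. $\epsilon$ is the unit of the Banach algebra $\mathcal{T}^*$: $\|\epsilon\|=1$ and $\epsilon*\rho=\rho=\rho*\epsilon$ for all $\rho\in\mathcal{T}^*$. 4. $\epsilon$ is a counit for $(\mathcal{T},\Delta)$: $(\epsilon\otimes\mathrm{id})(\Delta(A))=A=(\mathrm{id}\otimes\epsilon)(\Delta(A))$ for all $A\in\mathcal{T}$. -/

import Mathlib

open scoped TensorProduct InnerProductSpace ComplexConjugate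
open UniformSpace

set_option linter.unusedSectionVars false

noncomputable section

namespace ToeplitzQSG

section Tensor

variable {H K : Type*}
  [NormedAddCommGroup H] [InnerProductSpace ℂ H]
  [NormedAddCommGroup K] [InnerProductSpace ℂ K]

variable (H K) in
/-- The Hilbert space tensor product of `H` and `K`: the completion of the algebraic tensor
product for the inner product `⟪a ⊗ b, c ⊗ d⟫ = ⟪a, c⟫ * ⟪b, d⟫`. -/
def HTensor : Type _ := Completion (H ⊗[ℂ] K)

instance : NormedAddCommGroup (HTensor H K) :=
  inferInstanceAs (NormedAddCommGroup (Completion (H ⊗[ℂ] K)))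

instance : InnerProductSpace ℂ (HTensor H K) :=
  inferInstanceAs (InnerProductSpace ℂ (Completion (H ⊗[ℂ] K)))

instance : CompleteSpace (HTensor H K) :=
  inferInstanceAs (CompleteSpace (Completion (H ⊗[ℂ] K)))

variable (H K) in
/-- The inclusion of the algebraic tensor product. -/
def ofAlg : H ⊗[ℂ] K →ₗᵢ[ℂ] HTensor H K := Completion.toComplₗᵢ

theorem denseRange_ofAlg : DenseRange (ofAlg H K) := Completion.denseRange_coe

variable (H K) in
/-- The bounded bilinear map `(h, k) ↦ h ⊗ k`. -/
def tmulL : H →L[ℂ] K →L[ℂ] HTensor H K :=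
  (ContinuousLinearMap.compL ℂ K (H ⊗[ℂ] K) (HTensor H K) (ofAlg H K).toContinuousLinearMap).comp
    (TensorProduct.mkL ℂ H K)

theorem tmulL_apply (h : H) (k : K) : tmulL H K h k = ofAlg H K (h ⊗ₜ[ℂ] k) :=
  rfl

theorem inner_tmulL (h h' : H) (k k' : K) :
    ⟪tmulL H K h k, tmulL H K h' k'⟫_ℂ = ⟪h, h'⟫_ℂ * ⟪k, k'⟫_ℂ := by
  simp [tmulL_apply]

theorem dense_tmulL :
    Dense ((Submodule.span ℂ {z | ∃ h k, tmulL H K h k = z} : Submodule ℂ (HTensor H K)) :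
      Set (HTensor H K)) := by
  refine denseRange_ofAlg.mono ?_
  rintro _ ⟨t, rfl⟩
  induction t using TensorProduct.induction_on with
  | zero => simp
  | tmul h k => exact Submodule.subset_span ⟨h, k, rfl⟩
  | add a b ha hb =>
    rw [map_add]
    exact Submodule.add_mem _ ha hb

/-- Two bounded operators on a Hilbert tensor product agreeing on elementary tensors are equal. -/
theorem htensor_ext {M : Type*} [NormedAddCommGroup M] [NormedSpace ℂ M]
    {f g : HTensor H K →L[ℂ] M} (h : ∀ a b, f (tmulL H K a b) = g (tmulL H K a b)) : f = g := by
  refine ContinuousLinearMap.ext_on dense_tmulL ?_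
  rintro _ ⟨a, b, rfl⟩
  exact h a b

/-- The operator `a ⊗ b` on the Hilbert tensor product. -/
def tensorOp (a : H →L[ℂ] H) (b : K →L[ℂ] K) : HTensor H K →L[ℂ] HTensor H K :=
  ContinuousLinearMap.completion (TensorProduct.mapL a b)

theorem tensorOp_ofAlg (a : H →L[ℂ] H) (b : K →L[ℂ] K) (t : H ⊗[ℂ] K) :
    tensorOp a b (ofAlg H K t) = ofAlg H K (TensorProduct.mapL a b t) :=
  Completion.map_coe (TensorProduct.mapL a b).uniformContinuous t

@[simp]
theorem tensorOp_tmulL (a : H →L[ℂ] H) (b : K →L[ℂ] K) (h : H) (k : K) :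
    tensorOp a b (tmulL H K h k) = tmulL H K (a h) (b k) := by
  simp [tmulL_apply, tensorOp_ofAlg]

theorem tensorOp_mul (a a' : H →L[ℂ] H) (b b' : K →L[ℂ] K) :
    tensorOp a b * tensorOp a' b' = tensorOp (a * a') (b * b') :=
  htensor_ext fun h k => by simp

theorem tensorOp_one : tensorOp (1 : H →L[ℂ] H) (1 : K →L[ℂ] K) = 1 :=
  htensor_ext fun h k => by simp

variable [CompleteSpace H] [CompleteSpace K]

theorem tensorOp_star (a : H →L[ℂ] H) (b : K →L[ℂ] K) :
    star (tensorOp a b) = tensorOp (star a) (star b) := by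
  rw [ContinuousLinearMap.star_eq_adjoint, eq_comm, ContinuousLinearMap.eq_adjoint_iff]
  intro x y
  induction x, y using denseRange_ofAlg.induction_on₂ with
  | hp => exact isClosed_eq (by fun_prop) (by fun_prop)
  | h s t =>
    rw [tensorOp_ofAlg, tensorOp_ofAlg, LinearIsometry.inner_map_map, LinearIsometry.inner_map_map]
    induction s using TensorProduct.induction_on with
    | zero => simp
    | add u v hu hv => rw [map_add, inner_add_left, inner_add_left, hu, hv]
    | tmul h k =>
      induction t using TensorProduct.induction_on with
      | zero => simp
      | add u v hu hv => rw [map_add, inner_add_right, inner_add_right, hu, hv]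
      | tmul h' k' =>
        simp [ContinuousLinearMap.star_eq_adjoint, ContinuousLinearMap.adjoint_inner_left]

/-- The minimal (spatial) tensor product of the concrete algebras `S` and `R`: the norm closed
`*`-subalgebra of the operators on the Hilbert tensor product generated by the `a ⊗ b`. -/
def minTensor (S : StarSubalgebra ℂ (H →L[ℂ] H)) (R : StarSubalgebra ℂ (K →L[ℂ] K)) :
    StarSubalgebra ℂ (HTensor H K →L[ℂ] HTensor H K) :=
  (StarAlgebra.adjoin ℂ {x | ∃ a ∈ S, ∃ b ∈ R, tensorOp a b = x}).topologicalClosure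

instance isClosed_minTensor (S : StarSubalgebra ℂ (H →L[ℂ] H)) (R : StarSubalgebra ℂ (K →L[ℂ] K)) :
    IsClosed (minTensor S R : Set (HTensor H K →L[ℂ] HTensor H K)) :=
  StarSubalgebra.isClosed_topologicalClosure _

theorem tensorOp_mem {S : StarSubalgebra ℂ (H →L[ℂ] H)} {R : StarSubalgebra ℂ (K →L[ℂ] K)}
    {a : H →L[ℂ] H} {b : K →L[ℂ] K} (ha : a ∈ S) (hb : b ∈ R) : tensorOp a b ∈ minTensor S R :=
  StarSubalgebra.le_topologicalClosure _ (StarAlgebra.subset_adjoin ℂ _ ⟨a, ha, b, hb, rfl⟩)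

/-- The linear span of the elementary tensors is dense in the tensor product. -/
theorem minTensor_subset {S : StarSubalgebra ℂ (H →L[ℂ] H)} {R : StarSubalgebra ℂ (K →L[ℂ] K)}
    {V : Submodule ℂ (HTensor H K →L[ℂ] HTensor H K)}
    (hV : IsClosed (V : Set (HTensor H K →L[ℂ] HTensor H K)))
    (h : ∀ a ∈ S, ∀ b ∈ R, tensorOp a b ∈ V) {x : HTensor H K →L[ℂ] HTensor H K}
    (hx : x ∈ minTensor S R) : x ∈ V := by
  set W : Submodule ℂ (HTensor H K →L[ℂ] HTensor H K) :=
    Submodule.span ℂ {x | ∃ a ∈ S, ∃ b ∈ R, tensorOp a b = x} with hW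
  have hWV : W ≤ V := Submodule.span_le.2 (by rintro _ ⟨a, ha, b, hb, rfl⟩; exact h a ha b hb)
  have hmul : ∀ x ∈ W, ∀ y ∈ W, x * y ∈ W := by
    intro x hx y hy
    have := Submodule.mul_mem_mul hx hy
    rw [hW, Submodule.span_mul_span] at this
    refine Submodule.span_mono ?_ this
    rintro _ ⟨_, ⟨a, ha, b, hb, rfl⟩, _, ⟨a', ha', b', hb', rfl⟩, rfl⟩
    exact ⟨a * a', mul_mem ha ha', b * b', mul_mem hb hb', (tensorOp_mul _ _ _ _).symm⟩
  have hstar : ∀ x ∈ W, star x ∈ W := by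
    intro x hx
    induction hx using Submodule.span_induction with
    | zero => simp
    | add x y _ _ hx hy => rw [star_add]; exact W.add_mem hx hy
    | smul c x _ hx => rw [star_smul]; exact W.smul_mem _ hx
    | mem x hx =>
      obtain ⟨a, ha, b, hb, rfl⟩ := hx
      exact Submodule.subset_span ⟨_, star_mem ha, _, star_mem hb, (tensorOp_star a b).symm⟩
  have hle : ∀ x ∈ StarAlgebra.adjoin ℂ {x | ∃ a ∈ S, ∃ b ∈ R, tensorOp a b = x}, x ∈ W := by
    intro x hx
    induction hx using StarAlgebra.adjoin_induction with
    | mem x hx => exact Submodule.subset_span hx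
    | algebraMap r =>
      rw [Algebra.algebraMap_eq_smul_one, ← tensorOp_one]
      exact W.smul_mem _ (Submodule.subset_span ⟨1, one_mem _, 1, one_mem _, rfl⟩)
    | add x y _ _ hx hy => exact W.add_mem hx hy
    | mul x y _ _ hx hy => exact hmul x hx y hy
    | star x _ hx => exact hstar x hx
  exact closure_minimal (fun x hx => hWV (hle x hx)) hV hx

end Tensor

section Slice
variable {H K M : Type*}
  [NormedAddCommGroup H] [InnerProductSpace ℂ H] [CompleteSpace H]
  [NormedAddCommGroup K] [InnerProductSpace ℂ K] [CompleteSpace K]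
  [NormedAddCommGroup M] [InnerProductSpace ℂ M] [CompleteSpace M]

/-- For `J k h = h ⊗ k` (or `J h k = h ⊗ k`), slicing an operator `x` on the Hilbert tensor product
by a functional `ρ` is done through the sesquilinear form `(η, ξ) ↦ ρ ((J η)† x (J ξ))`. -/
def sliceForm (J : K →L[ℂ] H →L[ℂ] M) (ρ : StrongDual ℂ (H →L[ℂ] H)) (x : M →L[ℂ] M) :
    K →L⋆[ℂ] K →L[ℂ] ℂ :=
  LinearMap.mkContinuous₂
    (LinearMap.mk₂'ₛₗ (starRingEnd ℂ) (RingHom.id ℂ)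
      (fun η ξ => ρ ((J η).adjoint ∘L x ∘L J ξ))
      (fun a b c => by simp [ContinuousLinearMap.add_comp])
      (fun c a b => by
        rw [map_smul, map_smulₛₗ, ContinuousLinearMap.smul_comp, map_smul])
      (fun a b c => by simp [ContinuousLinearMap.comp_add])
      (fun c a b => by simp))
    (‖ρ‖ * ‖J‖ ^ 2 * ‖x‖) (fun η ξ => by
      have h1 : ‖(J η).adjoint ∘L x ∘L J ξ‖ ≤ (‖J‖ * ‖η‖) * (‖x‖ * (‖J‖ * ‖ξ‖)) := by
        refine (ContinuousLinearMap.opNorm_comp_le _ _).trans ?_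
        rw [LinearIsometryEquiv.norm_map]
        refine mul_le_mul (J.le_opNorm η) ?_ (norm_nonneg _) (by positivity)
        refine (ContinuousLinearMap.opNorm_comp_le _ _).trans ?_
        gcongr
        exact J.le_opNorm ξ
      calc ‖ρ ((J η).adjoint ∘L x ∘L J ξ)‖ ≤ ‖ρ‖ * ‖(J η).adjoint ∘L x ∘L J ξ‖ := ρ.le_opNorm _
        _ ≤ ‖ρ‖ * ((‖J‖ * ‖η‖) * (‖x‖ * (‖J‖ * ‖ξ‖))) := by gcongr
        _ = _ := by ring)

theorem sliceForm_apply (J : K →L[ℂ] H →L[ℂ] M) (ρ : StrongDual ℂ (H →L[ℂ] H)) (x : M →L[ℂ] M)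
    (η ξ : K) : sliceForm J ρ x η ξ = ρ ((J η).adjoint ∘L x ∘L J ξ) := rfl

theorem norm_sliceForm_le (J : K →L[ℂ] H →L[ℂ] M) (ρ : StrongDual ℂ (H →L[ℂ] H))
    (x : M →L[ℂ] M) : ‖sliceForm J ρ x‖ ≤ ‖ρ‖ * ‖J‖ ^ 2 * ‖x‖ :=
  LinearMap.mkContinuous₂_norm_le _ (by positivity) _

/-- The operator on `K` with `⟪η, (sliceOp J ρ x) ξ⟫ = ρ ((J η)† x (J ξ))`. -/
def sliceFun (J : K →L[ℂ] H →L[ℂ] M) (ρ : StrongDual ℂ (H →L[ℂ] H)) (x : M →L[ℂ] M) :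
    K →L[ℂ] K :=
  (InnerProductSpace.continuousLinearMapOfBilin (sliceForm J ρ x)).adjoint

theorem inner_sliceFun (J : K →L[ℂ] H →L[ℂ] M) (ρ : StrongDual ℂ (H →L[ℂ] H))
    (x : M →L[ℂ] M) (η ξ : K) :
    ⟪η, sliceFun J ρ x ξ⟫_ℂ = ρ ((J η).adjoint ∘L x ∘L J ξ) := by
  rw [sliceFun, ContinuousLinearMap.adjoint_inner_right,
    InnerProductSpace.continuousLinearMapOfBilin_apply, sliceForm_apply]

/-- `sliceFun` as a bounded linear map in the operator. -/
def sliceOp (J : K →L[ℂ] H →L[ℂ] M) (ρ : StrongDual ℂ (H →L[ℂ] H)) :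
    (M →L[ℂ] M) →L[ℂ] (K →L[ℂ] K) :=
  LinearMap.mkContinuous
    { toFun := sliceFun J ρ
      map_add' := fun x y => by
        ext ξ; refine ext_inner_left ℂ fun η => ?_
        simp [inner_sliceFun, inner_add_right, ContinuousLinearMap.add_comp,
          ContinuousLinearMap.comp_add]
      map_smul' := fun c x => by
        ext ξ; refine ext_inner_left ℂ fun η => ?_
        simp [inner_sliceFun, inner_smul_right, ContinuousLinearMap.smul_comp] }
    (‖ρ‖ * ‖J‖ ^ 2) (fun x => by
      refine le_trans ?_ (norm_sliceForm_le J ρ x)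
      simp only [LinearMap.coe_mk, AddHom.coe_mk, sliceFun, LinearIsometryEquiv.norm_map]
      refine ContinuousLinearMap.opNorm_le_bound _ (sliceForm J ρ x).opNorm_nonneg fun v => ?_
      simp only [InnerProductSpace.continuousLinearMapOfBilin, ContinuousLinearMap.comp_apply]
      refine le_trans (le_of_eq ?_) ((sliceForm J ρ x).le_opNorm v)
      simp )

theorem inner_sliceOp (J : K →L[ℂ] H →L[ℂ] M) (ρ : StrongDual ℂ (H →L[ℂ] H))
    (x : M →L[ℂ] M) (η ξ : K) :
    ⟪η, sliceOp J ρ x ξ⟫_ℂ = ρ ((J η).adjoint ∘L x ∘L J ξ) := inner_sliceFun J ρ x η ξ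

theorem norm_sliceOp_le (J : K →L[ℂ] H →L[ℂ] M) (ρ : StrongDual ℂ (H →L[ℂ] H)) :
    ‖sliceOp J ρ‖ ≤ ‖ρ‖ * ‖J‖ ^ 2 :=
  LinearMap.mkContinuous_norm_le _ (by positivity) _

end Slice

section SliceTensor

variable {H K : Type*}
  [NormedAddCommGroup H] [InnerProductSpace ℂ H] [CompleteSpace H]
  [NormedAddCommGroup K] [InnerProductSpace ℂ K] [CompleteSpace K]

theorem sliceOp_tensorOp (ρ : StrongDual ℂ (H →L[ℂ] H)) (a : H →L[ℂ] H) (b : K →L[ℂ] K) :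
    sliceOp (tmulL H K).flip ρ (tensorOp a b) = ρ a • b := by
  ext ξ
  refine ext_inner_left ℂ fun η => ?_
  rw [inner_sliceOp]
  have : ((tmulL H K).flip η).adjoint ∘L tensorOp a b ∘L (tmulL H K).flip ξ = ⟪η, b ξ⟫_ℂ • a := by
    ext h
    refine ext_inner_left ℂ fun h' => ?_
    simp [ContinuousLinearMap.adjoint_inner_right, inner_tmulL, inner_smul_right, mul_comm]
  rw [this]
  simp [inner_smul_right, mul_comm]

theorem sliceOp_tensorOp' (φ : StrongDual ℂ (K →L[ℂ] K)) (a : H →L[ℂ] H) (b : K →L[ℂ] K) :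
    sliceOp (tmulL H K) φ (tensorOp a b) = φ b • a := by
  ext ξ
  refine ext_inner_left ℂ fun η => ?_
  rw [inner_sliceOp]
  have : (tmulL H K η).adjoint ∘L tensorOp a b ∘L tmulL H K ξ = ⟪η, a ξ⟫_ℂ • b := by
    ext h
    refine ext_inner_left ℂ fun h' => ?_
    simp [ContinuousLinearMap.adjoint_inner_right, inner_tmulL, inner_smul_right]
  rw [this]
  simp [inner_smul_right, mul_comm]

theorem norm_tmulL_le : ‖tmulL H K‖ ≤ 1 := by
  refine ContinuousLinearMap.opNorm_le_bound₂ _ zero_le_one fun h k => ?_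
  rw [tmulL_apply, LinearIsometry.norm_map]
  simp

theorem exists_extension (S : StarSubalgebra ℂ (H →L[ℂ] H)) (ρ : StrongDual ℂ S) :
    ∃ ρ' : StrongDual ℂ (H →L[ℂ] H), (∀ a : S, ρ' a = ρ a) ∧ ‖ρ'‖ = ‖ρ‖ :=
  exists_extension_norm_eq (Subalgebra.toSubmodule S.toSubalgebra) ρ

variable (S : StarSubalgebra ℂ (H →L[ℂ] H)) (R : StarSubalgebra ℂ (K →L[ℂ] K))

/-- A norm preserving extension of a functional to all bounded operators. -/
def extendDual (ρ : StrongDual ℂ S) : StrongDual ℂ (H →L[ℂ] H) := (exists_extension S ρ).choose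

theorem extendDual_apply (ρ : StrongDual ℂ S) (a : H →L[ℂ] H) (ha : a ∈ S) :
    extendDual S ρ a = ρ ⟨a, ha⟩ := (exists_extension S ρ).choose_spec.1 ⟨a, ha⟩

theorem norm_extendDual (ρ : StrongDual ℂ S) : ‖extendDual S ρ‖ = ‖ρ‖ :=
  (exists_extension S ρ).choose_spec.2

theorem sliceOp_mem [hR : IsClosed (R : Set (K →L[ℂ] K))] (ρ : StrongDual ℂ S)
    (x : minTensor S R) : sliceOp (tmulL H K).flip (extendDual S ρ) x ∈ R := by
  refine minTensor_subset
    (V := (Subalgebra.toSubmodule R.toSubalgebra).comap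
      (sliceOp (tmulL H K).flip (extendDual S ρ)).toLinearMap)
    (hR.preimage (sliceOp (tmulL H K).flip (extendDual S ρ)).continuous) ?_ x.2
  intro a ha b hb
  change sliceOp _ _ _ ∈ R
  rw [sliceOp_tensorOp]
  exact R.smul_mem hb _

theorem sliceOp_mem' [hS : IsClosed (S : Set (H →L[ℂ] H))] (φ : StrongDual ℂ R)
    (x : minTensor S R) : sliceOp (tmulL H K) (extendDual R φ) x ∈ S := by
  refine minTensor_subset
    (V := (Subalgebra.toSubmodule S.toSubalgebra).comap
      (sliceOp (tmulL H K) (extendDual R φ)).toLinearMap)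
    (hS.preimage (sliceOp (tmulL H K) (extendDual R φ)).continuous) ?_ x.2
  intro a ha b hb
  change sliceOp _ _ _ ∈ S
  rw [sliceOp_tensorOp']
  exact S.smul_mem ha _

/-- The slice map `ρ ⊗ id : S ⊗ R → R`, i.e. the continuous linear map with
`a ⊗ b ↦ ρ(a) b`. -/
def sliceLeft [IsClosed (R : Set (K →L[ℂ] K))] (ρ : StrongDual ℂ S) : minTensor S R →L[ℂ] R where
  toFun x := ⟨sliceOp (tmulL H K).flip (extendDual S ρ) x, sliceOp_mem S R ρ x⟩
  map_add' x y := Subtype.ext (map_add (sliceOp (tmulL H K).flip (extendDual S ρ)) x.1 y.1)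
  map_smul' c x := Subtype.ext (map_smul (sliceOp (tmulL H K).flip (extendDual S ρ)) c x.1)
  cont := Continuous.subtype_mk
    ((sliceOp (tmulL H K).flip (extendDual S ρ)).continuous.comp continuous_subtype_val) _

/-- The slice map `id ⊗ φ : S ⊗ R → S`, i.e. the continuous linear map with
`a ⊗ b ↦ φ(b) a`. -/
def sliceRight [IsClosed (S : Set (H →L[ℂ] H))] (φ : StrongDual ℂ R) : minTensor S R →L[ℂ] S where
  toFun x := ⟨sliceOp (tmulL H K) (extendDual R φ) x, sliceOp_mem' S R φ x⟩
  map_add' x y := Subtype.ext (map_add (sliceOp (tmulL H K) (extendDual R φ)) x.1 y.1)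
  map_smul' c x := Subtype.ext (map_smul (sliceOp (tmulL H K) (extendDual R φ)) c x.1)
  cont := Continuous.subtype_mk
    ((sliceOp (tmulL H K) (extendDual R φ)).continuous.comp continuous_subtype_val) _

variable {S R}

/-- The elementary tensor `a ⊗ b` as an element of `S ⊗ R`. -/
def elemTensor (a : S) (b : R) : minTensor S R := ⟨tensorOp a.1 b.1, tensorOp_mem a.2 b.2⟩

theorem sliceLeft_elemTensor [IsClosed (R : Set (K →L[ℂ] K))] (ρ : StrongDual ℂ S) (a : S) (b : R) :
    sliceLeft S R ρ (elemTensor a b) = ρ a • b := by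
  refine Subtype.ext ?_
  change sliceOp (tmulL H K).flip (extendDual S ρ) (tensorOp a.1 b.1) = ρ a • b.1
  rw [sliceOp_tensorOp, extendDual_apply _ _ _ a.2]

theorem sliceRight_elemTensor [IsClosed (S : Set (H →L[ℂ] H))] (φ : StrongDual ℂ R) (a : S)
    (b : R) : sliceRight S R φ (elemTensor a b) = φ b • a := by
  refine Subtype.ext ?_
  change sliceOp (tmulL H K) (extendDual R φ) (tensorOp a.1 b.1) = φ b • a.1
  rw [sliceOp_tensorOp', extendDual_apply _ _ _ b.2]

theorem norm_sliceLeft_le [IsClosed (R : Set (K →L[ℂ] K))] (ρ : StrongDual ℂ S) :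
    ‖sliceLeft S R ρ‖ ≤ ‖ρ‖ := by
  refine ContinuousLinearMap.opNorm_le_bound _ (norm_nonneg _) fun x => ?_
  have h2 := (sliceOp (tmulL H K).flip (extendDual S ρ)).le_opNorm x.1
  have h3 := norm_sliceOp_le (tmulL H K).flip (extendDual S ρ)
  rw [norm_extendDual, ContinuousLinearMap.opNorm_flip] at h3
  have h4 : ‖ρ‖ * ‖tmulL H K‖ ^ 2 ≤ ‖ρ‖ :=
    mul_le_of_le_one_right (norm_nonneg _) (pow_le_one₀ (tmulL H K).opNorm_nonneg norm_tmulL_le)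
  exact h2.trans (mul_le_mul_of_nonneg_right (h3.trans h4) (norm_nonneg _))

/-- The tensor product `ρ ⊗ φ` of two continuous functionals: the continuous functional on
`S ⊗ R` with `a ⊗ b ↦ ρ(a) φ(b)`. -/
def tensorDual [IsClosed (R : Set (K →L[ℂ] K))] (ρ : StrongDual ℂ S) (φ : StrongDual ℂ R) :
    StrongDual ℂ (minTensor S R) := φ ∘L sliceLeft S R ρ

theorem tensorDual_elemTensor [IsClosed (R : Set (K →L[ℂ] K))] (ρ : StrongDual ℂ S)
    (φ : StrongDual ℂ R) (a : S) (b : R) : tensorDual ρ φ (elemTensor a b) = ρ a * φ b := by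
  simp [tensorDual, sliceLeft_elemTensor]

theorem norm_tensorDual_le [IsClosed (R : Set (K →L[ℂ] K))] (ρ : StrongDual ℂ S)
    (φ : StrongDual ℂ R) : ‖tensorDual ρ φ‖ ≤ ‖ρ‖ * ‖φ‖ := by
  refine (ContinuousLinearMap.opNorm_comp_le _ _).trans ?_
  rw [mul_comm]
  exact mul_le_mul_of_nonneg_right (norm_sliceLeft_le ρ) (norm_nonneg _)

end SliceTensor

section Basis

/-- The Hilbert space `ℓ²(ι)`. -/
abbrev L2 (ι : Type) : Type := lp (fun _ : ι => ℂ) 2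

/-- The standard orthonormal basis of `ℓ²(ι)`. -/
def stdBasis (ι : Type) : HilbertBasis ι ℂ (L2 ι) := ⟨LinearIsometryEquiv.refl ℂ _⟩

theorem stdBasis_apply {ι : Type} [DecidableEq ι] (i : ι) :
    stdBasis ι i = lp.single 2 i (1 : ℂ) := by
  rw [← HilbertBasis.repr_symm_single]; rfl

variable {ι κ : Type} {H K : Type*}
  [NormedAddCommGroup H] [InnerProductSpace ℂ H] [CompleteSpace H]
  [NormedAddCommGroup K] [InnerProductSpace ℂ K] [CompleteSpace K]

theorem basis_ext (b : HilbertBasis ι ℂ H) {M : Type*} [NormedAddCommGroup M] [NormedSpace ℂ M]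
    {f g : H →L[ℂ] M} (h : ∀ i, f (b i) = g (b i)) : f = g := by
  refine ContinuousLinearMap.ext_on
    (s := Set.range b) ?_ ?_
  · rw [dense_iff_closure_eq, ← Submodule.topologicalClosure_coe, b.dense_span]; rfl
  · rintro _ ⟨i, rfl⟩
    exact h i

theorem orthonormal_tmulL (b : HilbertBasis ι ℂ H) (c : HilbertBasis κ ℂ K) :
    Orthonormal ℂ (fun p : ι × κ => tmulL H K (b p.1) (c p.2)) := by
  classical
  rw [orthonormal_iff_ite]
  rintro ⟨i, j⟩ ⟨i', j'⟩
  rw [inner_tmulL, orthonormal_iff_ite.1 b.orthonormal, orthonormal_iff_ite.1 c.orthonormal]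
  by_cases h1 : i = i' <;> by_cases h2 : j = j' <;> simp [h1, h2]

theorem dense_span_tmulL (b : HilbertBasis ι ℂ H) (c : HilbertBasis κ ℂ K) :
    ⊤ ≤ (Submodule.span ℂ
      (Set.range fun p : ι × κ => tmulL H K (b p.1) (c p.2))).topologicalClosure := by
  set V := (Submodule.span ℂ
      (Set.range fun p : ι × κ => tmulL H K (b p.1) (c p.2))).topologicalClosure with hV
  have hVc : IsClosed (V : Set (HTensor H K)) := Submodule.isClosed_topologicalClosure _
  have h1 : ∀ i k, tmulL H K (b i) k ∈ V := by
    intro i k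
    have : k ∈ (Submodule.span ℂ (Set.range c)).topologicalClosure := by
      rw [c.dense_span]; trivial
    have h2 : (Submodule.span ℂ (Set.range c)).topologicalClosure ≤
        V.comap (tmulL H K (b i)).toLinearMap := by
      refine Submodule.topologicalClosure_minimal _ ?_
        (hVc.preimage (tmulL H K (b i)).continuous)
      rw [Submodule.span_le]
      rintro _ ⟨j, rfl⟩
      exact Submodule.le_topologicalClosure _ (Submodule.subset_span ⟨(i, j), rfl⟩)
    exact h2 this
  have h2 : ∀ h k, tmulL H K h k ∈ V := by
    intro h k
    have : h ∈ (Submodule.span ℂ (Set.range b)).topologicalClosure := by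
      rw [b.dense_span]; trivial
    have h2 : (Submodule.span ℂ (Set.range b)).topologicalClosure ≤
        V.comap ((tmulL H K).flip k).toLinearMap := by
      refine Submodule.topologicalClosure_minimal _ ?_
        (hVc.preimage ((tmulL H K).flip k).continuous)
      rw [Submodule.span_le]
      rintro _ ⟨i, rfl⟩
      exact h1 i k
    exact h2 this
  intro x _
  have h3 : Submodule.span ℂ {z | ∃ h k, tmulL H K h k = z} ≤ V :=
    Submodule.span_le.2 (by rintro _ ⟨h, k, rfl⟩; exact h2 h k)
  exact closure_minimal h3 hVc (dense_tmulL x)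

/-- The orthonormal basis `(b i ⊗ c j)` of the Hilbert tensor product, reindexed along `e`. -/
def tensorBasis {α : Type} (e : α ≃ ι × κ) (b : HilbertBasis ι ℂ H) (c : HilbertBasis κ ℂ K) :
    HilbertBasis α ℂ (HTensor H K) :=
  HilbertBasis.mk (v := fun a => tmulL H K (b (e a).1) (c (e a).2))
    ((orthonormal_tmulL b c).comp e e.injective) (by
      have := dense_span_tmulL b c
      rwa [← e.surjective.range_comp] at this)

theorem tensorBasis_apply {α : Type} (e : α ≃ ι × κ) (b : HilbertBasis ι ℂ H)
    (c : HilbertBasis κ ℂ K) (a : α) :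
    tensorBasis e b c a = tmulL H K (b (e a).1) (c (e a).2) := by
  simp [tensorBasis]

end Basis

section Shift

/-- The sequence `(0, f 0, f 1, …)`. -/
def shiftFun (f : ℕ → ℂ) : ℕ → ℂ
  | 0 => 0
  | n + 1 => f n

theorem hasSum_shiftFun {f : ℕ → ℂ} {s : ℝ} (h : HasSum (fun n => ‖f n‖ ^ (2 : ENNReal).toReal) s) :
    HasSum (fun n => ‖shiftFun f n‖ ^ (2 : ENNReal).toReal) s := by
  rw [← hasSum_nat_add_iff' 1]
  simpa [shiftFun] using h

theorem hasSum_norm (f : L2 ℕ) :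
    HasSum (fun n => ‖f n‖ ^ (2 : ENNReal).toReal) (‖f‖ ^ (2 : ENNReal).toReal) :=
  lp.hasSum_norm (by norm_num) f

/-- The unilateral right shift `T` on `ℓ²(ℕ)`. -/
def shift : L2 ℕ →L[ℂ] L2 ℕ :=
  LinearMap.mkContinuous
    { toFun := fun f => ⟨shiftFun f, memℓp_gen (hasSum_shiftFun (hasSum_norm f)).summable⟩
      map_add' := fun f g => by
        ext n
        cases n with
        | zero => exact (add_zero (0 : ℂ)).symm
        | succ n => rfl
      map_smul' := fun c f => by ext n; cases n <;> simp [shiftFun] } 1 (fun f => by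
    rw [one_mul]
    refine le_of_eq ?_
    rw [lp.norm_eq_tsum_rpow (by norm_num) f, lp.norm_eq_tsum_rpow (by norm_num)]
    congr 1
    exact (hasSum_shiftFun (hasSum_norm f)).tsum_eq.trans (hasSum_norm f).tsum_eq.symm)

theorem shift_apply_zero (f : L2 ℕ) : shift f 0 = 0 := rfl

theorem shift_apply_succ (f : L2 ℕ) (n : ℕ) : shift f (n + 1) = f n := rfl

theorem shift_stdBasis (n : ℕ) : shift (stdBasis ℕ n) = stdBasis ℕ (n + 1) := by
  ext k
  rw [stdBasis_apply, stdBasis_apply]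
  cases k with
  | zero => simp [shift_apply_zero]
  | succ k => simp [shift_apply_succ, Pi.single_apply]

theorem star_shift_mul_shift : star shift * shift = 1 := by
  ext1 f
  refine ext_inner_left ℂ fun g => ?_
  rw [mul_apply_eq_comp, ContinuousLinearMap.star_eq_adjoint,
    ContinuousLinearMap.adjoint_inner_right, one_apply_eq_self,
    lp.inner_eq_tsum, lp.inner_eq_tsum, (lp.summable_inner (𝕜 := ℂ) (shift g) (shift f)).tsum_eq_zero_add]
  simp [shift_apply_zero, shift_apply_succ]

/-- The Toeplitz algebra: the norm closed unital `*`-algebra generated by the shift. -/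
def Toeplitz : StarSubalgebra ℂ (L2 ℕ →L[ℂ] L2 ℕ) := StarAlgebra.elemental ℂ shift

instance isClosed_toeplitz : IsClosed (Toeplitz : Set (L2 ℕ →L[ℂ] L2 ℕ)) :=
  StarAlgebra.elemental.isClosed ℂ shift

instance : Ring Toeplitz := inferInstance
instance : Monoid Toeplitz := inferInstance
instance : Algebra ℂ Toeplitz := inferInstance

/-- The shift as an element of the Toeplitz algebra. -/
def genT : Toeplitz := ⟨shift, StarAlgebra.elemental.self_mem ℂ shift⟩

/-- The operators `T_{n,m} = Tⁿ (T*)ᵐ`. -/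
def opT (n m : ℕ) : Toeplitz := genT ^ n * star genT ^ m

end Shift

section Comult

/-- The bijection `(i, j) ↦ (i - j, min i j)`. -/
def diagEquiv : ℕ × ℕ ≃ ℤ × ℕ where
  toFun p := ((p.1 : ℤ) - p.2, min p.1 p.2)
  invFun q := (q.2 + q.1.toNat, q.2 + (-q.1).toNat)
  left_inv p := by
    ext
    · simp only; omega
    · simp only; omega
  right_inv q := by
    ext
    · simp only; omega
    · simp only; omega

/-- The unitary `ℓ²(ℕ) ⊗ ℓ²(ℕ) → ℓ²(ℤ) ⊗ ℓ²(ℕ)` with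
`e i ⊗ e j ↦ e (i - j) ⊗ e (min i j)`. -/
def diagUnitary : HTensor (L2 ℕ) (L2 ℕ) ≃ₗᵢ[ℂ] HTensor (L2 ℤ) (L2 ℕ) :=
  (tensorBasis (Equiv.refl _) (stdBasis ℕ) (stdBasis ℕ)).repr.trans
    (tensorBasis diagEquiv (stdBasis ℤ) (stdBasis ℕ)).repr.symm

theorem diagUnitary_apply (i j : ℕ) :
    diagUnitary (tmulL _ _ (stdBasis ℕ i) (stdBasis ℕ j)) =
      tmulL _ _ (stdBasis ℤ ((i : ℤ) - j)) (stdBasis ℕ (min i j)) := by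
  have h1 : tmulL _ _ (stdBasis ℕ i) (stdBasis ℕ j) =
    tensorBasis (Equiv.refl _) (stdBasis ℕ) (stdBasis ℕ) (i, j) := by
      rw [tensorBasis_apply]; rfl
  rw [h1, diagUnitary, LinearIsometryEquiv.trans_apply, HilbertBasis.repr_self,
    HilbertBasis.repr_symm_single, tensorBasis_apply]
  rfl

/-- The amplification `A ↦ 1 ⊗ A`. -/
def amplify : (L2 ℕ →L[ℂ] L2 ℕ) →⋆ₐ[ℂ] (HTensor (L2 ℤ) (L2 ℕ) →L[ℂ] HTensor (L2 ℤ) (L2 ℕ)) where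
  toFun A := tensorOp 1 A
  map_one' := tensorOp_one
  map_mul' A B := by rw [tensorOp_mul, one_mul]
  map_zero' := htensor_ext fun h k => by simp
  map_add' A B := htensor_ext fun h k => by simp
  commutes' c := htensor_ext fun h k => by simp [Algebra.algebraMap_eq_smul_one]
  map_star' A := by rw [tensorOp_star, star_one]

/-- The `*`-homomorphism `A ↦ U* (1 ⊗ A) U`, where `U` is the above unitary. -/
def comulFull : (L2 ℕ →L[ℂ] L2 ℕ) →⋆ₐ[ℂ]
    (HTensor (L2 ℕ) (L2 ℕ) →L[ℂ] HTensor (L2 ℕ) (L2 ℕ)) where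
  toFun A := diagUnitary.symm.conjStarAlgEquiv (amplify A)
  map_one' := by rw [map_one, map_one]
  map_mul' A B := by rw [map_mul, map_mul]
  map_zero' := by rw [map_zero, map_zero]
  map_add' A B := by rw [map_add, map_add]
  commutes' c := by rw [AlgHomClass.commutes, AlgEquivClass.commutes]
  map_star' A := by rw [map_star, map_star]

theorem comulFull_shift : comulFull shift = tensorOp shift shift := by
  refine basis_ext (tensorBasis (Equiv.refl _) (stdBasis ℕ) (stdBasis ℕ)) ?_
  rintro ⟨i, j⟩
  rw [tensorBasis_apply]
  change diagUnitary.symm (tensorOp 1 shift (diagUnitary (tmulL _ _ (stdBasis ℕ i) (stdBasis ℕ j))))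
    = tensorOp shift shift (tmulL _ _ (stdBasis ℕ i) (stdBasis ℕ j))
  rw [diagUnitary_apply, tensorOp_tmulL, tensorOp_tmulL, LinearIsometryEquiv.symm_apply_eq,
    shift_stdBasis, shift_stdBasis, shift_stdBasis, diagUnitary_apply,
    one_apply_eq_self]
  congr 3 <;> [push_cast; skip] <;> [ring; omega]

theorem comulFull_mem (A : Toeplitz) : comulFull A ∈ minTensor Toeplitz Toeplitz := by
  have hc : Continuous comulFull :=
    AddMonoidHomClass.continuous_of_bound comulFull 1 fun x => by
      rw [one_mul]; exact NonUnitalStarAlgHom.norm_apply_le comulFull x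
  have h1 : StarAlgebra.adjoin ℂ {shift} ≤
      (minTensor Toeplitz Toeplitz).comap comulFull := by
    rw [StarAlgebra.adjoin_le_iff]
    rintro _ rfl
    change comulFull shift ∈ minTensor Toeplitz Toeplitz
    rw [comulFull_shift]
    exact tensorOp_mem genT.2 genT.2
  exact closure_minimal h1 ((isClosed_minTensor Toeplitz Toeplitz).preimage hc) A.2

/-- The comultiplication of the Toeplitz algebra: the unital `*`-homomorphism `Δ : 𝒯 → 𝒯 ⊗ 𝒯`
with `Δ(T) = T ⊗ T` (a `*`-homomorphism on `𝒯` is determined by its value at `T`). -/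
def comul : Toeplitz →⋆ₐ[ℂ] minTensor Toeplitz Toeplitz :=
  StarAlgHom.codRestrict (comulFull.comp Toeplitz.subtype) _ comulFull_mem

theorem comul_genT : comul genT = elemTensor genT genT := Subtype.ext comulFull_shift

theorem star_genT_mul_genT : star genT * genT = 1 := Subtype.ext star_shift_mul_shift

theorem star_genT_pow_mul (m : ℕ) : star genT ^ m * genT ^ m = 1 := by
  induction m with
  | zero => simp
  | succ m ih =>
    rw [pow_succ, pow_succ' genT, mul_assoc, ← mul_assoc (star genT), star_genT_mul_genT, one_mul,
      ih]

theorem comul_opT (n m : ℕ) : comul (opT n m) = elemTensor (opT n m) (opT n m) := by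
  have hmul : ∀ a b a' b' : Toeplitz,
      elemTensor a b * elemTensor a' b' = elemTensor (a * a') (b * b') :=
    fun a b a' b' => Subtype.ext (tensorOp_mul _ _ _ _)
  have hone : elemTensor (1 : Toeplitz) (1 : Toeplitz) = 1 := Subtype.ext tensorOp_one
  have hpow : ∀ (a b : Toeplitz) (k : ℕ), elemTensor a b ^ k = elemTensor (a ^ k) (b ^ k) := by
    intro a b k
    induction k with
    | zero => simp only [pow_zero, hone]
    | succ k ih => rw [pow_succ, ih, hmul, pow_succ, pow_succ]
  have hstar : star (elemTensor genT genT) = elemTensor (star genT) (star genT) :=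
    Subtype.ext (tensorOp_star _ _)
  rw [opT, map_mul, map_pow, map_pow, map_star, comul_genT, hstar, hpow, hpow, hmul]

/-- The comultiplication as a continuous linear map. -/
def comulL : Toeplitz →L[ℂ] minTensor Toeplitz Toeplitz :=
  LinearMap.mkContinuous comul.toAlgHom.toLinearMap 1 fun x => by
    rw [one_mul]; exact NonUnitalStarAlgHom.norm_apply_le comul x

theorem comulL_apply (A : Toeplitz) : comulL A = comul A := rfl

theorem norm_comulL_le : ‖comulL‖ ≤ 1 := LinearMap.mkContinuous_norm_le _ zero_le_one _

end Comult

section Dual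

theorem opT_mul_opT (n m k l : ℕ) : ∃ p q, opT n m * opT k l = opT p q := by
  rcases le_total m k with h | h
  · obtain ⟨d, rfl⟩ := Nat.exists_eq_add_of_le h
    refine ⟨n + d, l, ?_⟩
    rw [opT, opT, opT, pow_add genT m d, mul_assoc, mul_assoc, ← mul_assoc (star genT ^ m),
      star_genT_pow_mul, one_mul, pow_add, mul_assoc]
  · obtain ⟨d, rfl⟩ := Nat.exists_eq_add_of_le' h
    refine ⟨n, d + l, ?_⟩
    rw [opT, opT, opT, pow_add _ d k, mul_assoc, mul_assoc, ← mul_assoc (star genT ^ k),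
      star_genT_pow_mul, one_mul, pow_add]

/-- The linear combinations of the `T_{n,m}` are dense in the Toeplitz algebra. -/
theorem dense_span_opT :
    Dense ((Submodule.span ℂ (Set.range fun p : ℕ × ℕ => opT p.1 p.2) : Submodule ℂ Toeplitz) :
      Set Toeplitz) := by
  set W : Submodule ℂ Toeplitz := Submodule.span ℂ (Set.range fun p : ℕ × ℕ => opT p.1 p.2) with hW
  have hmul : ∀ x ∈ W, ∀ y ∈ W, x * y ∈ W := by
    intro x hx y hy
    have := Submodule.mul_mem_mul hx hy
    rw [hW, Submodule.span_mul_span] at this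
    refine Submodule.span_mono ?_ this
    rintro _ ⟨_, ⟨⟨n, m⟩, rfl⟩, _, ⟨⟨k, l⟩, rfl⟩, rfl⟩
    obtain ⟨p, q, h⟩ := opT_mul_opT n m k l
    exact ⟨(p, q), h.symm⟩
  have hle : ∀ x ∈ StarAlgebra.adjoin ℂ {shift}, ∃ y ∈ W, (y : L2 ℕ →L[ℂ] L2 ℕ) = x := by
    intro x hx
    rw [← StarSubalgebra.mem_toSubalgebra, StarAlgebra.adjoin_toSubalgebra] at hx
    induction hx using Algebra.adjoin_induction with
    | mem x hx =>
      rcases hx with hx | hx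
      · obtain rfl : x = shift := hx
        exact ⟨opT 1 0, Submodule.subset_span ⟨(1, 0), rfl⟩, by simp [opT, genT]⟩
      · obtain hx : star x = shift := hx
        refine ⟨opT 0 1, Submodule.subset_span ⟨(0, 1), rfl⟩, ?_⟩
        rw [← star_star x, hx]
        simp [opT, genT]
    | algebraMap r =>
      refine ⟨r • opT 0 0, W.smul_mem _ (Submodule.subset_span ⟨(0, 0), rfl⟩), ?_⟩
      rw [Algebra.algebraMap_eq_smul_one]
      simp [opT]
    | add x y _ _ hx hy =>
      obtain ⟨x', hx', rfl⟩ := hx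
      obtain ⟨y', hy', rfl⟩ := hy
      exact ⟨x' + y', W.add_mem hx' hy', rfl⟩
    | mul x y _ _ hx hy =>
      obtain ⟨x', hx', rfl⟩ := hx
      obtain ⟨y', hy', rfl⟩ := hy
      exact ⟨x' * y', hmul _ hx' _ hy', rfl⟩
  intro A
  rw [closure_subtype]
  refine closure_mono ?_ A.2
  intro x hx
  obtain ⟨y, hy, rfl⟩ := hle x hx
  exact ⟨y, hy, rfl⟩

theorem dual_ext {ρ φ : StrongDual ℂ Toeplitz} (h : ∀ n m, ρ (opT n m) = φ (opT n m)) : ρ = φ := by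
  refine ContinuousLinearMap.ext_on dense_span_opT ?_
  rintro _ ⟨⟨n, m⟩, rfl⟩
  exact h n m

/-- The convolution `(ρ * φ)(A) = (ρ ⊗ φ)(Δ A)` on the dual of the Toeplitz algebra. -/
def conv (ρ φ : StrongDual ℂ Toeplitz) : StrongDual ℂ Toeplitz := tensorDual ρ φ ∘L comulL

theorem conv_opT (ρ φ : StrongDual ℂ Toeplitz) (n m : ℕ) :
    conv ρ φ (opT n m) = ρ (opT n m) * φ (opT n m) := by
  rw [conv, ContinuousLinearMap.comp_apply, comulL_apply, comul_opT, tensorDual_elemTensor]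

/-- The dual of the Toeplitz algebra, with its dual norm and the product `(ρ * φ)(A) = (ρ ⊗ φ)(Δ A)`,
is a commutative Banach algebra. -/
instance : NonUnitalNormedCommRing (StrongDual ℂ Toeplitz) where
  __ := (inferInstance : NormedAddCommGroup (StrongDual ℂ Toeplitz))
  mul := conv
  left_distrib ρ φ ψ := dual_ext fun n m =>
    (conv_opT _ _ n m).trans <| (mul_add _ _ _).trans <| Eq.symm <|
      congrArg₂ (· + ·) (conv_opT _ _ n m) (conv_opT _ _ n m)
  right_distrib ρ φ ψ := dual_ext fun n m =>
    (conv_opT _ _ n m).trans <| (add_mul _ _ _).trans <| Eq.symm <|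
      congrArg₂ (· + ·) (conv_opT _ _ n m) (conv_opT _ _ n m)
  zero_mul ρ := dual_ext fun n m => (conv_opT _ _ n m).trans (zero_mul _)
  mul_zero ρ := dual_ext fun n m => (conv_opT _ _ n m).trans (mul_zero _)
  mul_assoc ρ φ ψ := dual_ext fun n m => by
    change conv (conv ρ φ) ψ _ = conv ρ (conv φ ψ) _
    rw [conv_opT, conv_opT, conv_opT, conv_opT, mul_assoc]
  mul_comm ρ φ := dual_ext fun n m => by
    change conv ρ φ _ = conv φ ρ _
    rw [conv_opT, conv_opT, mul_comm]
  norm_mul_le ρ φ := by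
    change ‖conv ρ φ‖ ≤ _
    refine (ContinuousLinearMap.opNorm_comp_le _ _).trans ?_
    exact (mul_le_of_le_one_right (norm_nonneg _) norm_comulL_le).trans (norm_tensorDual_le ρ φ)

theorem dual_mul_apply (ρ φ : StrongDual ℂ Toeplitz) (A : Toeplitz) :
    (ρ * φ) A = tensorDual ρ φ (comul A) := rfl

instance : IsScalarTower ℂ (StrongDual ℂ Toeplitz) (StrongDual ℂ Toeplitz) where
  smul_assoc c ρ φ := dual_ext fun n m => by
    change conv (c • ρ) φ _ = c * conv ρ φ _
    rw [conv_opT, conv_opT, ← mul_assoc]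
    rfl

instance : SMulCommClass ℂ (StrongDual ℂ Toeplitz) (StrongDual ℂ Toeplitz) where
  smul_comm c ρ φ := dual_ext fun n m => by
    change c * conv ρ φ _ = conv ρ (c • φ) _
    rw [conv_opT, conv_opT, mul_left_comm]
    rfl

/-- The ideal `𝒦` of the compact operators in the Toeplitz algebra. -/
def compactIdeal : Submodule ℂ Toeplitz where
  carrier := {A | IsCompactOperator (A : L2 ℕ →L[ℂ] L2 ℕ)}
  zero_mem' := isCompactOperator_zero
  add_mem' hA hB := hA.add hB
  smul_mem' c _ hA := hA.smul c

theorem mem_compactIdeal {A : Toeplitz} :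
    A ∈ compactIdeal ↔ IsCompactOperator (A : L2 ℕ →L[ℂ] L2 ℕ) := Iff.rfl

end Dual


end ToeplitzQSG

end

open ToeplitzQSG

/-! Everything reduces to the operators T_{n,m}, whose span is dense. Since Δ(T_{n,m}) = T_{n,m} ⊗
T_{n,m}, convolution multiplies the values of functionals at each T_{n,m}, so a continuous
functional equal to 1 at all of them is a unit and a counit, and is unique. What has to be shown is
that it exists and that it comes from the symbol map.

The symbol is built point by point. The vector (1, w, w², …) with |w| < 1 is an eigenvector of T*,
so its normalized vector state sends T_{n,m} to w̄ⁿwᵐ. As w tends radially to z in S¹, weak-*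
compactness gives a contractive functional with T_{n,m} ↦ z^{m-n} (`exists_boundary_functional`). On
the Toeplitz algebra it is a character. It kills the matrix units T_{n,m} - T_{n+1,m+1}, hence all
compact operators (`mem_of_isCompactOperator`); the same identity puts 𝒦 inside 𝒯.

The inverse modulo 𝒦 is f ↦ T_f, the compression to ℓ²(ℕ) of the functional calculus of the
bilateral shift. It is contractive, and T_{γ(A)} - A is compact
(`isCompactOperator_toeplitzOp_symbol_sub`). Hence ker γ = 𝒦, and since both γ and f ↦ T_f are
contractions, γ induces an isometry of 𝒯/𝒦 onto C(S¹) (`norm_mk_eq_norm_symbol`). The counit is ε(A)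
= γ(A)(1). -/

noncomputable section

namespace ToeplitzQSG

open Filter Topology InnerProductSpace

/-! ### Approximation of compact operators by matrix units -/

section Compact

variable {ι H : Type*} [NormedAddCommGroup H] [InnerProductSpace ℂ H]

/-- The truncation `y ↦ ∑ i ∈ s, ⟪b i, y⟫ • b i` of the expansion in an orthonormal family is a
contraction. -/
theorem norm_sum_rankOne_le {b : ι → H} (hb : Orthonormal ℂ b) (s : Finset ι) :
    ‖∑ i ∈ s, rankOne ℂ (b i) (b i)‖ ≤ 1 := by
  refine ContinuousLinearMap.opNorm_le_bound _ zero_le_one fun y => ?_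
  rw [one_mul, ← sq_le_sq₀ (norm_nonneg _) (norm_nonneg _)]
  refine le_trans (le_of_eq ?_) (hb.sum_inner_products_le y (s := s))
  simp only [_root_.sum_apply, rankOne_apply]
  have h := inner_self_eq_norm_sq_to_K (𝕜 := ℂ) (∑ i ∈ s, ⟪b i, y⟫_ℂ • b i)
  rw [hb.inner_sum] at h
  apply Complex.ofReal_injective
  push_cast
  refine h.symm.trans (Finset.sum_congr rfl fun i _ => ?_)
  exact Complex.conj_mul' _

variable [CompleteSpace H]

theorem tendsto_sum_rankOne (b : HilbertBasis ι ℂ H) (y : H) :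
    Tendsto (fun s : Finset ι => (∑ i ∈ s, rankOne ℂ (b i) (b i)) y) atTop (𝓝 y) := by
  simpa [HasSum, b.repr_apply_apply] using b.hasSum_repr y

/-- The truncations of a compact operator converge to it in norm. -/
theorem tendsto_sum_rankOne_comp (b : HilbertBasis ι ℂ H) {K : H →L[ℂ] H}
    (hK : IsCompactOperator K) :
    Tendsto (fun s : Finset ι => (∑ i ∈ s, rankOne ℂ (b i) (b i)) ∘L K) atTop (𝓝 K) := by
  rw [Metric.tendsto_nhds]
  intro ε hε
  -- The strong convergence of the truncations is uniform on a finite net of the image of the unit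
  -- ball. Three errors of size ε/6 add up to ε/2, which leaves room for the strict inequality after
  -- taking the supremum over unit vectors.
  obtain ⟨t, ht, hcov⟩ := Metric.totallyBounded_iff.1
    (hK.isCompact_closure_image_closedBall 1).totallyBounded (ε / 6) (by positivity)
  have hev : ∀ᶠ s : Finset ι in atTop, ∀ y ∈ t,
      dist ((∑ i ∈ s, rankOne ℂ (b i) (b i)) y) y < ε / 6 :=
    (eventually_all_finite ht).2 fun y _ =>
      Metric.tendsto_nhds.1 (tendsto_sum_rankOne b y) _ (by positivity)
  filter_upwards [hev] with s hs
  set P := ∑ i ∈ s, rankOne ℂ (b i) (b i) with hP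
  rw [dist_eq_norm]
  refine lt_of_le_of_lt (b := ε / 2) ?_ (by linarith)
  refine ContinuousLinearMap.opNorm_le_of_unit_norm (𝕜 := ℂ) (by positivity) fun x hx => ?_
  have hmem : K x ∈ closure (K '' Metric.closedBall 0 1) :=
    subset_closure ⟨x, by simp [hx], rfl⟩
  obtain ⟨y, hy, hxy⟩ := Set.mem_iUnion₂.1 (hcov hmem)
  rw [Metric.mem_ball, dist_eq_norm] at hxy
  have h1 := hs y hy
  rw [dist_eq_norm] at h1
  have h2 : ‖P (K x - y)‖ ≤ ε / 6 := by
    refine (P.le_opNorm _).trans ?_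
    calc ‖P‖ * ‖K x - y‖ ≤ 1 * ‖K x - y‖ := by
          gcongr; exact norm_sum_rankOne_le b.orthonormal s
      _ ≤ ε / 6 := by rw [one_mul]; exact hxy.le
  have h3 : (P ∘L K - K) x = P (K x - y) + (P y - y) - (K x - y) := by
    simp
  rw [h3]
  refine (norm_sub_le _ _).trans ?_
  have := norm_add_le (P (K x - y)) (P y - y)
  linarith

/-- A closed subspace of operators that contains the matrix units of an orthonormal basis contains
all compact operators. -/
theorem mem_of_isCompactOperator (b : HilbertBasis ι ℂ H) {V : Submodule ℂ (H →L[ℂ] H)}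
    (hV : IsClosed (V : Set (H →L[ℂ] H))) (h : ∀ i j, rankOne ℂ (b i) (b j) ∈ V)
    {K : H →L[ℂ] H} (hK : IsCompactOperator K) : K ∈ V := by
  -- Truncating K on the left gives terms with first vector `b i` and second vector K†(b i), so only
  -- the second vector has to be arbitrary.
  have h1 : ∀ i y, rankOne ℂ (b i) y ∈ V := by
    intro i y
    have hc : Continuous fun z : H => rankOne ℂ (b i) z := (rankOne ℂ (b i)).continuous
    refine hV.mem_of_tendsto (hc.continuousAt.tendsto.comp (tendsto_sum_rankOne b y))
      (Eventually.of_forall fun s => ?_)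
    simp only [Function.comp, _root_.sum_apply, rankOne_apply, map_sum, map_smulₛₗ]
    exact sum_mem fun j _ => V.smul_mem _ (h i j)
  refine hV.mem_of_tendsto (tendsto_sum_rankOne_comp b hK) (Eventually.of_forall fun s => ?_)
  rw [ContinuousLinearMap.finsetSum_comp]
  refine sum_mem fun i _ => ?_
  rw [rankOne_comp]
  exact h1 _ _

theorem isCompactOperator_rankOne (x y : H) : IsCompactOperator (rankOne ℂ x y) := by
  exact (isCompactOperator_of_locallyCompactSpace_dom (innerSL ℂ y)).clm_comp
    (ContinuousLinearMap.toSpanSingleton ℂ x)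

end Compact

/-! ### Matrix units and compact operators in the Toeplitz algebra -/

section ShiftOperators

theorem star_shift_apply (f : L2 ℕ) (n : ℕ) : star shift f n = f (n + 1) := by
  have h : ∀ (g : L2 ℕ) k, ⟪stdBasis ℕ k, g⟫_ℂ = g k := fun g k => by
    rw [stdBasis_apply, lp.inner_single_left]; simp
  rw [← h, ContinuousLinearMap.star_eq_adjoint, ContinuousLinearMap.adjoint_inner_right,
    shift_stdBasis, h]

theorem one_sub_shift_mul_star :
    1 - shift * star shift = rankOne ℂ (stdBasis ℕ 0) (stdBasis ℕ 0) := by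
  ext f n
  change f n - shift (star shift f) n = (⟪stdBasis ℕ 0, f⟫_ℂ • stdBasis ℕ 0) n
  rw [stdBasis_apply, lp.inner_single_left]
  cases n with
  | zero => simp [shift_apply_zero]
  | succ n => simp [shift_apply_succ, star_shift_apply]

theorem shift_pow_stdBasis (n : ℕ) : (shift ^ n) (stdBasis ℕ 0) = stdBasis ℕ n := by
  induction n with
  | zero => rfl
  | succ n ih => rw [pow_succ', mul_apply_eq_comp, ih, shift_stdBasis]

theorem coe_opT (n m : ℕ) : (opT n m : L2 ℕ →L[ℂ] L2 ℕ) = shift ^ n * star shift ^ m := rfl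

/-- The difference is Tⁿ(1 - TT*)T*ᵐ, and 1 - TT* is the projection onto the first basis vector.
This puts every matrix unit in the Toeplitz algebra. -/
theorem opT_sub_opT_succ (n m : ℕ) :
    (opT n m : L2 ℕ →L[ℂ] L2 ℕ) - opT (n + 1) (m + 1) =
      rankOne ℂ (stdBasis ℕ n) (stdBasis ℕ m) := by
  have h : (opT n m : L2 ℕ →L[ℂ] L2 ℕ) - opT (n + 1) (m + 1) =
      shift ^ n * ((1 - shift * star shift) * star shift ^ m) := by
    rw [coe_opT, coe_opT, pow_succ shift, pow_succ' (star shift), sub_mul, mul_sub, one_mul]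
    simp only [mul_assoc]
  rw [h, one_sub_shift_mul_star, ContinuousLinearMap.mul_def, ContinuousLinearMap.mul_def,
    rankOne_comp, comp_rankOne, shift_pow_stdBasis, ← star_pow,
    ContinuousLinearMap.star_eq_adjoint, ContinuousLinearMap.adjoint_adjoint, shift_pow_stdBasis]

theorem mem_toeplitz_of_isCompactOperator {K : L2 ℕ →L[ℂ] L2 ℕ} (hK : IsCompactOperator K) :
    K ∈ Toeplitz := by
  refine mem_of_isCompactOperator (V := Subalgebra.toSubmodule Toeplitz.toSubalgebra)
    (stdBasis ℕ) isClosed_toeplitz (fun i j => ?_) hK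
  rw [← opT_sub_opT_succ]
  exact sub_mem (opT i j).2 (opT (i + 1) (j + 1)).2

/-- A property of Toeplitz operators holds for all of them if it holds for the `T_{n,m}` and defines
a closed subspace. -/
theorem toeplitz_induction {p : Toeplitz → Prop} (hp : IsClosed {A | p A})
    (hT : ∀ n m, p (opT n m)) (hadd : ∀ A B, p A → p B → p (A + B))
    (hsmul : ∀ (c : ℂ) A, p A → p (c • A)) (A : Toeplitz) : p A := by
  refine hp.closure_subset_iff.2 ?_ (dense_span_opT A)
  intro B hB
  induction hB using Submodule.span_induction with
  | mem x hx => obtain ⟨⟨n, m⟩, rfl⟩ := hx; exact hT n m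
  -- The zero operator is 0 • T_{0,0}, so it needs no hypothesis of its own.
  | zero => simpa using hsmul 0 _ (hT 0 0)
  | add x y _ _ hx hy => exact hadd x y hx hy
  | smul c x _ hx => exact hsmul c x hx

end ShiftOperators

/-! ### Vector states of geometric sequences and their boundary limits -/

section Berezin

theorem memℓp_geometric {w : ℂ} (hw : ‖w‖ < 1) : Memℓp (fun n : ℕ => w ^ n) 2 := by
  refine memℓp_gen ?_
  have h : (fun n : ℕ => ‖w ^ n‖ ^ (2 : ENNReal).toReal) = fun n => (‖w‖ ^ 2) ^ n := by
    ext n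
    rw [ENNReal.toReal_ofNat, norm_pow, Real.rpow_two, ← pow_mul, ← pow_mul, mul_comm]
  rw [h]
  exact summable_geometric_of_lt_one (by positivity) (pow_lt_one₀ (norm_nonneg _) hw two_ne_zero)

/-- The sequence `(1, w, w², …)`. -/
def geomVec {w : ℂ} (hw : ‖w‖ < 1) : L2 ℕ := ⟨fun n => w ^ n, memℓp_geometric hw⟩

theorem geomVec_apply {w : ℂ} (hw : ‖w‖ < 1) (n : ℕ) : geomVec hw n = w ^ n := rfl

theorem geomVec_ne_zero {w : ℂ} (hw : ‖w‖ < 1) : geomVec hw ≠ 0 := by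
  intro h
  have : geomVec hw 0 = 0 := by rw [h]; rfl
  simp [geomVec_apply] at this

/-- T* drops the first entry, which multiplies a geometric sequence by its ratio. -/
theorem star_shift_pow_geomVec {w : ℂ} (hw : ‖w‖ < 1) (m : ℕ) :
    (star shift ^ m) (geomVec hw) = w ^ m • geomVec hw := by
  induction m with
  | zero => simp
  | succ m ih =>
    rw [pow_succ', mul_apply_eq_comp, ih, map_smul, pow_succ, mul_smul]
    congr 1
    ext n
    rw [star_shift_apply, lp.coeFn_smul, Pi.smul_apply, geomVec_apply, geomVec_apply, pow_succ',
      smul_eq_mul]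

/-- The Berezin transform at `w`: the vector state of the normalized geometric sequence. -/
def berezin {w : ℂ} (hw : ‖w‖ < 1) : StrongDual ℂ (L2 ℕ →L[ℂ] L2 ℕ) :=
  LinearMap.mkContinuous
    { toFun := fun A => ⟪geomVec hw, A (geomVec hw)⟫_ℂ / ‖geomVec hw‖ ^ 2
      map_add' := fun A B => by simp [add_div]
      map_smul' := fun c A => by simp [mul_div_assoc] } 1 (fun A => by
    have h : 0 < ‖geomVec hw‖ := norm_pos_iff.2 (geomVec_ne_zero hw)
    change ‖⟪geomVec hw, A (geomVec hw)⟫_ℂ / (‖geomVec hw‖ : ℂ) ^ 2‖ ≤ _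
    rw [norm_div, norm_pow, Complex.norm_real, norm_norm, div_le_iff₀ (by positivity)]
    calc _ ≤ ‖geomVec hw‖ * (‖A‖ * ‖geomVec hw‖) :=
          (norm_inner_le_norm _ _).trans (by gcongr; exact A.le_opNorm _)
      _ = _ := by ring)

theorem norm_berezin_le {w : ℂ} (hw : ‖w‖ < 1) : ‖berezin hw‖ ≤ 1 :=
  LinearMap.mkContinuous_norm_le _ zero_le_one _

theorem berezin_opT {w : ℂ} (hw : ‖w‖ < 1) (n m : ℕ) :
    berezin hw (opT n m) = conj w ^ n * w ^ m := by
  have h : (‖geomVec hw‖ : ℂ) ≠ 0 := by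
    simpa using geomVec_ne_zero hw
  change ⟪geomVec hw, (shift ^ n) ((star shift ^ m) (geomVec hw))⟫_ℂ / (‖geomVec hw‖ : ℂ) ^ 2 = _
  have h2 : shift ^ n = (star shift ^ n).adjoint := by
    rw [← ContinuousLinearMap.star_eq_adjoint, star_pow, star_star]
  rw [h2, ContinuousLinearMap.adjoint_inner_right, star_shift_pow_geomVec, star_shift_pow_geomVec,
    inner_smul_left, inner_smul_right, inner_self_eq_norm_sq_to_K, map_pow]
  field_simp
  simp

/-- Boundary values of the Berezin transform exist as functionals on all bounded operators. -/
theorem exists_boundary_functional (z : Circle) :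
    ∃ ω : StrongDual ℂ (L2 ℕ →L[ℂ] L2 ℕ), ‖ω‖ ≤ 1 ∧
      ∀ n m, ω (opT n m) = conj (z : ℂ) ^ n * (z : ℂ) ^ m := by
  -- The radii 1 - 1/(k+1) start at 0, stay below 1 and tend to 1.
  have hr : ∀ k : ℕ, ‖((1 - 1 / ((k : ℝ) + 1) : ℝ) : ℂ) * z‖ < 1 := by
    intro k
    have h1 : 1 / ((k : ℝ) + 1) ≤ 1 := by
      rw [div_le_one (by positivity)]; linarith [(Nat.cast_nonneg k : (0 : ℝ) ≤ k)]
    have h2 : 0 < 1 / ((k : ℝ) + 1) := by positivity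
    rw [norm_mul, Circle.norm_coe, mul_one, Complex.norm_real, Real.norm_of_nonneg (by linarith)]
    linarith
  have hlim : Tendsto (fun k : ℕ => ((1 - 1 / ((k : ℝ) + 1) : ℝ) : ℂ) * (z : ℂ)) atTop
      (𝓝 (z : ℂ)) := by
    have h1 : Tendsto (fun k : ℕ => 1 - 1 / ((k : ℝ) + 1)) atTop (𝓝 (1 - 0)) :=
      tendsto_const_nhds.sub tendsto_one_div_add_atTop_nhds_zero_nat
    rw [sub_zero] at h1
    simpa using ((Complex.continuous_ofReal.tendsto 1).comp h1).mul_const (z : ℂ)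
  -- Banach–Alaoglu: the states lie in the weak-* compact unit ball, so they have a cluster point.
  obtain ⟨ω, hω, hcl⟩ := (WeakDual.isCompact_closedBall (𝕜 := ℂ)
      (0 : StrongDual ℂ (L2 ℕ →L[ℂ] L2 ℕ)) 1).exists_mapClusterPt (f := atTop)
    (u := fun k : ℕ => StrongDual.toWeakDual (berezin (hr k)))
    (tendsto_principal.2 <| Eventually.of_forall fun k => by
      simpa using norm_berezin_le (hr k))
  refine ⟨WeakDual.toStrongDual ω, by simpa using hω, fun n m => ?_⟩
  have h1 : MapClusterPt (ω (opT n m)) atTop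
      ((fun φ : WeakDual ℂ (L2 ℕ →L[ℂ] L2 ℕ) => φ (opT n m)) ∘
        fun k : ℕ => StrongDual.toWeakDual (berezin (hr k))) :=
    hcl.continuousAt_comp (WeakDual.eval_continuous _).continuousAt
  have h2 : Tendsto ((fun φ : WeakDual ℂ (L2 ℕ →L[ℂ] L2 ℕ) => φ (opT n m)) ∘
        fun k : ℕ => StrongDual.toWeakDual (berezin (hr k))) atTop
      (𝓝 (conj (z : ℂ) ^ n * (z : ℂ) ^ m)) := by
    have h3 : Continuous fun w : ℂ => conj w ^ n * w ^ m := by fun_prop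
    refine ((h3.tendsto _).comp hlim).congr fun k => ?_
    exact (berezin_opT (hr k) n m).symm
  -- At T_{n,m} the values converge, so the cluster value must be their limit.
  exact eq_of_nhds_neBot (NeBot.mono h1 (inf_le_inf_left _ h2))

end Berezin

/-! ### The symbol map -/

section Symbol

/-- A boundary value at `z` of the Berezin transform. -/
def boundaryFunctional (z : Circle) : StrongDual ℂ (L2 ℕ →L[ℂ] L2 ℕ) :=
  (exists_boundary_functional z).choose

theorem norm_boundaryFunctional_le (z : Circle) : ‖boundaryFunctional z‖ ≤ 1 :=
  (exists_boundary_functional z).choose_spec.1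

theorem boundaryFunctional_opT (z : Circle) (n m : ℕ) :
    boundaryFunctional z (opT n m) = conj (z : ℂ) ^ n * (z : ℂ) ^ m :=
  (exists_boundary_functional z).choose_spec.2 n m

theorem conj_circle_mul_self (z : Circle) : conj (z : ℂ) * z = 1 := by
  rw [Complex.conj_mul', Circle.norm_coe]; simp

/-- Since z̄z = 1, the functional takes the same value at T_{i,j} and T_{i+1,j+1}, so it vanishes on
their difference, a matrix unit. Its kernel is closed. -/
theorem boundaryFunctional_of_isCompactOperator (z : Circle) {K : L2 ℕ →L[ℂ] L2 ℕ}
    (hK : IsCompactOperator K) : boundaryFunctional z K = 0 := by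
  refine mem_of_isCompactOperator (V := (boundaryFunctional z).toLinearMap.ker)
    (stdBasis ℕ) (isClosed_singleton.preimage (boundaryFunctional z).continuous) (fun i j => ?_) hK
  rw [LinearMap.mem_ker, ← opT_sub_opT_succ, map_sub]
  change boundaryFunctional z (opT i j) - boundaryFunctional z (opT (i + 1) (j + 1)) = 0
  rw [boundaryFunctional_opT, boundaryFunctional_opT, pow_succ, pow_succ' (z : ℂ), mul_assoc,
    ← mul_assoc (conj (z : ℂ)) (z : ℂ), conj_circle_mul_self, one_mul, sub_self]

/-- The evaluation at `z` of the symbol of a Toeplitz operator. -/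
def symbolAt (z : Circle) : StrongDual ℂ Toeplitz where
  toFun A := boundaryFunctional z A
  map_add' A B := map_add (boundaryFunctional z) A.1 B.1
  map_smul' c A := map_smul (boundaryFunctional z) c A.1
  cont := (boundaryFunctional z).continuous.comp continuous_subtype_val

theorem symbolAt_opT (z : Circle) (n m : ℕ) :
    symbolAt z (opT n m) = conj (z : ℂ) ^ n * (z : ℂ) ^ m := boundaryFunctional_opT z n m

theorem norm_symbolAt_apply_le (z : Circle) (A : Toeplitz) : ‖symbolAt z A‖ ≤ ‖A‖ := by
  refine ((boundaryFunctional z).le_opNorm A).trans ?_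
  exact mul_le_of_le_one_left (norm_nonneg _) (norm_boundaryFunctional_le z)

/-- In the product, T*ᵐTᵏ cancels to a single power of T or T* because T*T = 1; the scalars cancel
in the same way because z̄z = 1. -/
theorem symbolAt_opT_mul_opT (z : Circle) (n m k l : ℕ) :
    symbolAt z (opT n m * opT k l) = symbolAt z (opT n m) * symbolAt z (opT k l) := by
  have hz : ∀ j : ℕ, (z : ℂ) ^ j * conj (z : ℂ) ^ j = 1 := fun j => by
    rw [← mul_pow, mul_comm, conj_circle_mul_self, one_pow]
  rcases le_total m k with h | h
  · obtain ⟨d, rfl⟩ := Nat.exists_eq_add_of_le h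
    have : opT n m * opT (m + d) l = opT (n + d) l := by
      rw [opT, opT, opT, pow_add genT m d, mul_assoc, mul_assoc, ← mul_assoc (star genT ^ m),
        star_genT_pow_mul, one_mul, pow_add, mul_assoc]
    rw [this, symbolAt_opT, symbolAt_opT, symbolAt_opT, pow_add, pow_add]
    linear_combination -(conj (z : ℂ) ^ n * conj (z : ℂ) ^ d * (z : ℂ) ^ l) * hz m
  · obtain ⟨d, rfl⟩ := Nat.exists_eq_add_of_le' h
    have : opT n (d + k) * opT k l = opT n (d + l) := by
      rw [opT, opT, opT, pow_add _ d k, mul_assoc, mul_assoc, ← mul_assoc (star genT ^ k),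
        star_genT_pow_mul, one_mul, pow_add]
    rw [this, symbolAt_opT, symbolAt_opT, symbolAt_opT, pow_add, pow_add]
    linear_combination -(conj (z : ℂ) ^ n * (z : ℂ) ^ d * (z : ℂ) ^ l) * hz k

theorem symbolAt_mul (z : Circle) (A B : Toeplitz) :
    symbolAt z (A * B) = symbolAt z A * symbolAt z B := by
  refine toeplitz_induction (p := fun A => symbolAt z (A * B) = symbolAt z A * symbolAt z B)
    (isClosed_eq (by fun_prop) (by fun_prop)) (fun n m => ?_) (fun A A' h h' => ?_)
    (fun c A h => ?_) A
  · refine toeplitz_induction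
      (p := fun B => symbolAt z (opT n m * B) = symbolAt z (opT n m) * symbolAt z B)
      (isClosed_eq (by fun_prop) (by fun_prop)) (symbolAt_opT_mul_opT z n m) (fun A A' h h' => ?_)
      (fun c A h => ?_) B
    · rw [mul_add, map_add, map_add, h, h', mul_add]
    · rw [mul_smul_comm, map_smul, map_smul, h, mul_smul_comm]
  · rw [add_mul, map_add, map_add, h, h', add_mul]
  · rw [smul_mul_assoc, map_smul, map_smul, h, smul_mul_assoc]

theorem star_opT (n m : ℕ) : star (opT n m) = opT m n := by
  rw [opT, opT, star_mul, star_pow, star_pow, star_star]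

theorem symbolAt_star (z : Circle) (A : Toeplitz) :
    symbolAt z (star A) = conj (symbolAt z A) := by
  refine toeplitz_induction (p := fun A => symbolAt z (star A) = conj (symbolAt z A))
    (isClosed_eq ((symbolAt z).continuous.comp continuous_star)
      (Complex.continuous_conj.comp (symbolAt z).continuous)) (fun n m => ?_) (fun A A' h h' => ?_)
    (fun c A h => ?_) A
  · rw [star_opT, symbolAt_opT, symbolAt_opT]
    simp [mul_comm]
  · rw [star_add, map_add, map_add, h, h', map_add]
  · rw [star_smul, map_smul, map_smul, h, smul_eq_mul, smul_eq_mul, map_mul]; rfl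

/-- The functionals are contractive with one bound for all z, so norm convergence of operators gives
uniform convergence of the functions of z, and continuity passes to the limit. -/
theorem continuous_symbolAt (A : Toeplitz) : Continuous fun z => symbolAt z A := by
  refine toeplitz_induction (p := fun A => Continuous fun z => symbolAt z A)
    ?_ (fun n m => ?_) (fun A A' h h' => ?_) (fun c A h => ?_) A
  · refine isClosed_of_closure_subset fun A hA => ?_
    refine continuous_of_uniform_approx_of_continuous fun u hu => ?_
    obtain ⟨ε, hε, hu⟩ := Metric.mem_uniformity_dist.1 hu
    obtain ⟨B, hB, hAB⟩ := Metric.mem_closure_iff.1 hA ε hε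
    refine ⟨_, hB, fun z => hu ?_⟩
    rw [dist_eq_norm, ← map_sub]
    rw [dist_eq_norm] at hAB
    exact (norm_symbolAt_apply_le z _).trans_lt hAB
  · simp only [symbolAt_opT]
    fun_prop
  · simp only [map_add]
    exact h.add h'
  · simp only [map_smul]
    exact h.const_smul c

theorem symbolAt_one (z : Circle) : symbolAt z 1 = 1 := by
  have h : opT 0 0 = 1 := by simp [opT]
  rw [← h, symbolAt_opT]; simp

/-- The symbol map of the Toeplitz algebra. -/
def symbol : Toeplitz →⋆ₐ[ℂ] C(Circle, ℂ) where
  toFun A := ⟨fun z => symbolAt z A, continuous_symbolAt A⟩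
  map_one' := by ext z; exact symbolAt_one z
  map_mul' A B := by ext z; exact symbolAt_mul z A B
  map_zero' := by ext z; exact map_zero (symbolAt z)
  map_add' A B := by ext z; exact map_add (symbolAt z) A B
  commutes' c := by
    ext z
    rw [Algebra.algebraMap_eq_smul_one]
    change symbolAt z (c • 1) = _
    rw [map_smul, symbolAt_one, Algebra.algebraMap_eq_smul_one]
    rfl
  map_star' A := by ext z; exact symbolAt_star z A

theorem symbol_apply (A : Toeplitz) (z : Circle) : symbol A z = symbolAt z A := rfl

theorem symbol_opT (n m : ℕ) (z : Circle) :
    symbol (opT n m) z = (z : ℂ) ^ ((m : ℤ) - (n : ℤ)) := by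
  have hz : (z : ℂ) ≠ 0 := z.coe_ne_zero
  have h : conj (z : ℂ) = (z : ℂ)⁻¹ := eq_inv_of_mul_eq_one_left (conj_circle_mul_self z)
  rw [symbol_apply, symbolAt_opT, h, zpow_sub₀ hz, zpow_natCast, zpow_natCast, inv_pow, mul_comm,
    div_eq_mul_inv]

theorem norm_symbol_le (A : Toeplitz) : ‖symbol A‖ ≤ ‖A‖ :=
  (ContinuousMap.norm_le _ (norm_nonneg _)).2 fun z => norm_symbolAt_apply_le z A

theorem continuous_symbol : Continuous symbol :=
  AddMonoidHomClass.continuous_of_bound symbol 1 fun A => by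
    rw [one_mul]; exact norm_symbol_le A

theorem symbol_of_isCompactOperator {A : Toeplitz}
    (hA : IsCompactOperator (A : L2 ℕ →L[ℂ] L2 ℕ)) : symbol A = 0 := by
  ext z
  exact boundaryFunctional_of_isCompactOperator z hA

end Symbol

/-! ### Toeplitz operators as compressions from ℓ²(ℤ) -/

section Dilation

/-- The unitary operator that permutes an orthonormal basis. -/
def permUnitary {ι H : Type*} [NormedAddCommGroup H] [InnerProductSpace ℂ H] [CompleteSpace H]
    (b : HilbertBasis ι ℂ H) (σ : Equiv.Perm ι) : H ≃ₗᵢ[ℂ] H :=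
  b.repr.trans (HilbertBasis.mk (b.orthonormal.comp σ σ.injective) (by
    rw [σ.surjective.range_comp]; exact b.dense_span.ge)).repr.symm

theorem permUnitary_apply {ι H : Type*} [NormedAddCommGroup H] [InnerProductSpace ℂ H]
    [CompleteSpace H] (b : HilbertBasis ι ℂ H) (σ : Equiv.Perm ι) (i : ι) :
    permUnitary b σ (b i) = b (σ i) := by
  classical
  rw [permUnitary, LinearIsometryEquiv.trans_apply, HilbertBasis.repr_self,
    HilbertBasis.repr_symm_single]
  simp

/-- The bilateral shift `e i ↦ e (i + 1)` on `ℓ²(ℤ)`. -/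
def bilateralShift : unitary (L2 ℤ →L[ℂ] L2 ℤ) :=
  Unitary.linearIsometryEquiv.symm (permUnitary (stdBasis ℤ) (Equiv.addRight 1))

theorem bilateralShift_stdBasis (i : ℤ) :
    (bilateralShift : L2 ℤ →L[ℂ] L2 ℤ) (stdBasis ℤ i) = stdBasis ℤ (i + 1) :=
  permUnitary_apply (stdBasis ℤ) _ i

/-- The isometric embedding of `ℓ²(ℕ)` in `ℓ²(ℤ)`. -/
def natEmbedding : L2 ℕ →ₗᵢ[ℂ] L2 ℤ :=
  ((stdBasis ℤ).orthonormal.comp ((↑) : ℕ → ℤ) Nat.cast_injective).orthogonalFamily.linearIsometry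

theorem natEmbedding_stdBasis (i : ℕ) : natEmbedding (stdBasis ℕ i) = stdBasis ℤ i := by
  rw [stdBasis_apply, natEmbedding, OrthogonalFamily.linearIsometry_apply_single]
  simp

/-- The image of ℓ²(ℕ) is invariant under the bilateral shift, which restricts there to T. -/
theorem bilateralShift_pow_comp (n : ℕ) :
    ((bilateralShift : L2 ℤ →L[ℂ] L2 ℤ) ^ n) ∘L natEmbedding.toContinuousLinearMap =
      natEmbedding.toContinuousLinearMap ∘L (shift ^ n) := by
  have h1 : (bilateralShift : L2 ℤ →L[ℂ] L2 ℤ) ∘L natEmbedding.toContinuousLinearMap =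
      natEmbedding.toContinuousLinearMap ∘L shift := by
    refine basis_ext (stdBasis ℕ) fun i => ?_
    change (bilateralShift : L2 ℤ →L[ℂ] L2 ℤ) (natEmbedding (stdBasis ℕ i)) =
      natEmbedding (shift (stdBasis ℕ i))
    rw [natEmbedding_stdBasis, bilateralShift_stdBasis, shift_stdBasis, natEmbedding_stdBasis]
    push_cast
    rfl
  induction n with
  | zero => rfl
  | succ n ih =>
    rw [pow_succ, ContinuousLinearMap.mul_def, ContinuousLinearMap.comp_assoc, h1,
      ← ContinuousLinearMap.comp_assoc, ih, pow_succ, ContinuousLinearMap.mul_def,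
      ContinuousLinearMap.comp_assoc]

/-- The representation of `C(S¹)` on `ℓ²(ℤ)` that maps the function `z` to the adjoint of the
bilateral shift. -/
def circleRep : C(Circle, ℂ) →⋆ₐ[ℂ] (L2 ℤ →L[ℂ] L2 ℤ) :=
  -- The adjoint is used because T has symbol z⁻¹. The spectrum of a unitary lies in the circle, so
  -- f is first restricted to the spectrum.
  (cfcHom (R := ℂ) (a := ((star bilateralShift : unitary (L2 ℤ →L[ℂ] L2 ℤ)) : L2 ℤ →L[ℂ] L2 ℤ))
    (Unitary.coe_isStarNormal _)).comp
    (ContinuousMap.compStarAlgHom' ℂ ℂ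
      ⟨fun w => (⟨w.1, Unitary.spectrum_subset_circle _ w.2⟩ : Circle),
        Continuous.subtype_mk continuous_subtype_val _⟩)

theorem circleRep_coe (f : C(Circle, ℂ)) (hf : ∀ z, f z = z) :
    circleRep f = star (bilateralShift : L2 ℤ →L[ℂ] L2 ℤ) := by
  refine Eq.trans ?_ (cfcHom_id (R := ℂ) (Unitary.coe_isStarNormal (star bilateralShift)))
  change cfcHom _ _ = cfcHom _ _
  congr 1
  ext w
  exact hf _

theorem norm_circleRep_le (f : C(Circle, ℂ)) : ‖circleRep f‖ ≤ ‖f‖ :=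
  NonUnitalStarAlgHom.norm_apply_le circleRep f

/-- The Toeplitz operator with symbol `f`. -/
def toeplitzOp : C(Circle, ℂ) →L[ℂ] (L2 ℕ →L[ℂ] L2 ℕ) :=
  LinearMap.mkContinuous
    { toFun := fun f => natEmbedding.toContinuousLinearMap.adjoint ∘L circleRep f ∘L
        natEmbedding.toContinuousLinearMap
      map_add' := fun f g => by
        rw [map_add, ContinuousLinearMap.add_comp, ContinuousLinearMap.comp_add]
      map_smul' := fun c f => by
        rw [map_smul, ContinuousLinearMap.smul_comp, ContinuousLinearMap.comp_smul,
          RingHom.id_apply] } 1 (fun f => by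
    have h : ‖natEmbedding.toContinuousLinearMap‖ ≤ 1 := natEmbedding.norm_toContinuousLinearMap_le
    have h' : ‖natEmbedding.toContinuousLinearMap.adjoint‖ ≤ 1 := by
      rwa [LinearIsometryEquiv.norm_map]
    change ‖natEmbedding.toContinuousLinearMap.adjoint ∘L circleRep f ∘L
        natEmbedding.toContinuousLinearMap‖ ≤ 1 * ‖f‖
    calc _ ≤ 1 * (‖f‖ * 1) := by
          refine (ContinuousLinearMap.opNorm_comp_le _ _).trans ?_
          gcongr
          refine (ContinuousLinearMap.opNorm_comp_le _ _).trans ?_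
          gcongr
          exact norm_circleRep_le f
      _ = 1 * ‖f‖ := by rw [mul_one])

theorem toeplitzOp_apply (f : C(Circle, ℂ)) :
    toeplitzOp f = natEmbedding.toContinuousLinearMap.adjoint ∘L circleRep f ∘L
      natEmbedding.toContinuousLinearMap := rfl

theorem norm_toeplitzOp_le (f : C(Circle, ℂ)) : ‖toeplitzOp f‖ ≤ ‖f‖ := by
  refine (toeplitzOp.le_opNorm f).trans ?_
  exact mul_le_of_le_one_left (norm_nonneg _) (LinearMap.mkContinuous_norm_le _ zero_le_one _)

theorem toeplitzOp_star (f : C(Circle, ℂ)) : toeplitzOp (star f) = star (toeplitzOp f) := by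
  rw [toeplitzOp_apply, toeplitzOp_apply, map_star, ContinuousLinearMap.star_eq_adjoint,
    ContinuousLinearMap.star_eq_adjoint, ContinuousLinearMap.adjoint_comp,
    ContinuousLinearMap.adjoint_comp, ContinuousLinearMap.adjoint_adjoint,
    ContinuousLinearMap.comp_assoc]

theorem circleRep_symbol_genT :
    circleRep (symbol genT) = (bilateralShift : L2 ℤ →L[ℂ] L2 ℤ) := by
  -- The representation is known at the function z, which is the symbol of T*, not of T.
  rw [← star_star genT, map_star, map_star, circleRep_coe, star_star]
  intro z
  have h : star genT = opT 0 1 := by simp [opT]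
  rw [h, symbol_opT]
  simp

/-- With V the embedding and U the bilateral shift, V†UⁿV = V†VTⁿ = Tⁿ. -/
theorem toeplitzOp_symbol_genT_pow (n : ℕ) : toeplitzOp (symbol (genT ^ n)) = shift ^ n := by
  rw [toeplitzOp_apply, map_pow, map_pow, circleRep_symbol_genT, bilateralShift_pow_comp,
    ← ContinuousLinearMap.comp_assoc,
    ContinuousLinearMap.norm_map_iff_adjoint_comp_self _ |>.1 natEmbedding.norm_map]
  rfl

/-- The compact operators form a closed subspace, so A = T_{n,m} suffices. Passing to T_{n+1,m+1}
keeps the symbol and changes the operator by rank one. This reduces to n = 0 or m = 0, where the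
difference is zero: for powers of T by invariance of ℓ²(ℕ), for powers of T* by taking adjoints. -/
theorem isCompactOperator_toeplitzOp_symbol_sub (A : Toeplitz) :
    IsCompactOperator (toeplitzOp (symbol A) - A : L2 ℕ →L[ℂ] L2 ℕ) := by
  have hc : Continuous fun A : Toeplitz => toeplitzOp (symbol A) - (A : L2 ℕ →L[ℂ] L2 ℕ) :=
    (toeplitzOp.continuous.comp continuous_symbol).sub continuous_subtype_val
  refine toeplitz_induction
    (p := fun A => IsCompactOperator (toeplitzOp (symbol A) - A : L2 ℕ →L[ℂ] L2 ℕ))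
    (isClosed_setOfPred_isCompactOperator.preimage hc) (fun n m => ?_) (fun A B hA hB => ?_)
    (fun c A hA => ?_) A
  · have hstep : ∀ n m, IsCompactOperator
          (toeplitzOp (symbol (opT n m)) - opT n m : L2 ℕ →L[ℂ] L2 ℕ) →
        IsCompactOperator
          (toeplitzOp (symbol (opT (n + 1) (m + 1))) - opT (n + 1) (m + 1) : L2 ℕ →L[ℂ] L2 ℕ) := by
      intro n m h
      have h1 : symbol (opT (n + 1) (m + 1)) = symbol (opT n m) := by
        ext z
        rw [symbol_opT, symbol_opT]
        push_cast
        ring_nf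
      rw [h1, ← sub_add_sub_cancel _ (opT n m : L2 ℕ →L[ℂ] L2 ℕ), opT_sub_opT_succ]
      exact h.add (isCompactOperator_rankOne _ _)
    have hzero : ∀ n, toeplitzOp (symbol (opT n 0)) = (opT n 0 : L2 ℕ →L[ℂ] L2 ℕ) := fun n => by
      rw [coe_opT, opT, pow_zero, pow_zero, mul_one, mul_one, toeplitzOp_symbol_genT_pow]
    induction n generalizing m with
    | zero =>
      have h : toeplitzOp (symbol (opT 0 m)) = (opT 0 m : L2 ℕ →L[ℂ] L2 ℕ) := by
        rw [← star_opT, map_star, toeplitzOp_star, hzero]; rfl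
      rw [h, sub_self]
      exact isCompactOperator_zero
    | succ n ih =>
      cases m with
      | zero =>
        rw [hzero, sub_self]
        exact isCompactOperator_zero
      | succ m => exact hstep n m (ih m)
  · have h : toeplitzOp (symbol (A + B)) - ((A + B : Toeplitz) : L2 ℕ →L[ℂ] L2 ℕ) =
        (toeplitzOp (symbol A) - A) + (toeplitzOp (symbol B) - B) := by
      rw [map_add, map_add, sub_add_sub_comm]; rfl
    rw [h]
    exact hA.add hB
  · have h : toeplitzOp (symbol (c • A)) - ((c • A : Toeplitz) : L2 ℕ →L[ℂ] L2 ℕ) =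
        c • (toeplitzOp (symbol A) - A) := by
      rw [map_smul, map_smul, smul_sub]; rfl
    rw [h]
    exact hA.smul c

end Dilation

/-! ### The quotient by the compact operators -/

section Quotient

theorem separatesPoints_range_symbol : symbol.range.SeparatesPoints := by
  intro x y hxy
  refine ⟨symbol (opT 0 1), ⟨_, ⟨opT 0 1, rfl⟩, rfl⟩, fun h => hxy ?_⟩
  rw [symbol_opT, symbol_opT] at h
  exact Circle.ext (by simpa using h)

theorem denseRange_symbol : DenseRange symbol := by
  intro f
  have h := ContinuousMap.starSubalgebra_topologicalClosure_eq_top_of_separatesPoints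
    symbol.range separatesPoints_range_symbol
  have hf : f ∈ symbol.range.topologicalClosure := by rw [h]; trivial
  exact hf

/-- The operator is A plus a compact operator, and both lie in the Toeplitz algebra. -/
theorem toeplitzOp_symbol_mem (A : Toeplitz) : toeplitzOp (symbol A) ∈ Toeplitz := by
  have h := add_mem (mem_toeplitz_of_isCompactOperator (isCompactOperator_toeplitzOp_symbol_sub A))
    A.2
  rwa [sub_add_cancel] at h

theorem toeplitzOp_mem (f : C(Circle, ℂ)) : toeplitzOp f ∈ Toeplitz :=
  (isClosed_toeplitz.preimage toeplitzOp.continuous).closure_subset_iff.2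
    (by rintro _ ⟨A, rfl⟩; exact toeplitzOp_symbol_mem A) (denseRange_symbol f)

/-- By density it suffices to take f the symbol of some A; then the Toeplitz operator differs from A
by a compact operator, which has symbol zero. In particular the symbol map is onto, not only of
dense range. -/
theorem symbol_toeplitzOp (f : C(Circle, ℂ)) : symbol ⟨toeplitzOp f, toeplitzOp_mem f⟩ = f := by
  have hc : Continuous fun f => symbol ⟨toeplitzOp f, toeplitzOp_mem f⟩ :=
    continuous_symbol.comp (toeplitzOp.continuous.subtype_mk _)
  refine congrFun (denseRange_symbol.equalizer hc continuous_id (funext fun A => ?_)) f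
  set B : Toeplitz := ⟨toeplitzOp (symbol A), toeplitzOp_mem _⟩
  have hK : IsCompactOperator ((B - A : Toeplitz) : L2 ℕ →L[ℂ] L2 ℕ) := by
    rw [AddSubgroupClass.coe_sub]
    exact isCompactOperator_toeplitzOp_symbol_sub A
  have h := symbol_of_isCompactOperator hK
  rw [map_sub, sub_eq_zero] at h
  exact h

theorem mem_compactIdeal_iff_symbol_eq_zero {A : Toeplitz} : A ∈ compactIdeal ↔ symbol A = 0 := by
  refine ⟨symbol_of_isCompactOperator, fun h => ?_⟩
  have h1 := isCompactOperator_toeplitzOp_symbol_sub A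
  rw [h, map_zero, zero_sub] at h1
  simpa [mem_compactIdeal] using h1.neg

theorem ker_symbol : symbol.toAlgHom.toLinearMap.ker = compactIdeal := by
  ext A
  exact mem_compactIdeal_iff_symbol_eq_zero.symm

/-- The Toeplitz operator with the symbol of A represents the class of A and has norm at most that
of the symbol. Conversely, all representatives share the symbol, whose norm bounds theirs from
below. -/
theorem norm_mk_eq_norm_symbol (A : Toeplitz) :
    ‖(Submodule.Quotient.mk A : Toeplitz ⧸ compactIdeal)‖ = ‖symbol A‖ := by
  have hmk : ∀ B : Toeplitz, symbol B = symbol A →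
      (Submodule.Quotient.mk B : Toeplitz ⧸ compactIdeal) = Submodule.Quotient.mk A := by
    intro B h
    rw [Submodule.Quotient.eq, mem_compactIdeal_iff_symbol_eq_zero, map_sub, h, sub_self]
  refine le_antisymm ?_ (le_of_forall_pos_lt_add fun ε hε => ?_)
  · rw [← hmk _ (symbol_toeplitzOp (symbol A))]
    exact (Submodule.Quotient.norm_mk_le _ _).trans (norm_toeplitzOp_le _)
  · obtain ⟨B, hB, hlt⟩ := Submodule.Quotient.norm_mk_lt
      (Submodule.Quotient.mk A : Toeplitz ⧸ compactIdeal) hε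
    rw [Submodule.Quotient.eq, mem_compactIdeal_iff_symbol_eq_zero, map_sub, sub_eq_zero] at hB
    rw [← hB]
    exact (norm_symbol_le B).trans_lt hlt

/-- The isometric isomorphism of the quotient by the compact operators with `C(S¹)` that is induced
by the symbol map. -/
def symbolEquiv : (Toeplitz ⧸ compactIdeal) ≃ₗᵢ[ℂ] C(Circle, ℂ) where
  __ := (Submodule.quotEquivOfEq _ _ ker_symbol.symm).trans
    (symbol.toAlgHom.toLinearMap.quotKerEquivOfSurjective fun f => ⟨_, symbol_toeplitzOp f⟩)
  norm_map' x := by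
    obtain ⟨A, rfl⟩ := Submodule.Quotient.mk_surjective _ x
    exact (norm_mk_eq_norm_symbol A).symm

theorem symbolEquiv_mk (A : Toeplitz) : symbolEquiv (Submodule.Quotient.mk A) = symbol A := rfl

end Quotient

/-! ### The counit and the unit of the dual algebra -/

section Counit

/-- The counit: the evaluation of the symbol at `1`. -/
def counit : StrongDual ℂ Toeplitz := symbolAt 1

theorem counit_opT (n m : ℕ) : counit (opT n m) = 1 := by
  rw [counit, symbolAt_opT]; simp

theorem norm_counit : ‖counit‖ = 1 := by
  have hle : ‖counit‖ ≤ 1 := counit.opNorm_le_bound zero_le_one fun A => by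
    rw [one_mul]; exact norm_symbolAt_apply_le 1 A
  refine le_antisymm hle ?_
  -- The lower bound comes from the value 1 at the identity operator.
  have h := counit.le_opNorm 1
  have h1 : ‖(1 : Toeplitz)‖ ≤ 1 := ContinuousLinearMap.norm_id_le
  rw [counit, symbolAt_one, norm_one] at h
  exact h.trans (mul_le_of_le_one_right (norm_nonneg _) h1)

theorem counit_mul (ρ : StrongDual ℂ Toeplitz) : counit * ρ = ρ :=
  dual_ext fun n m => (conv_opT _ _ n m).trans (by rw [counit_opT, one_mul])

/-- Both sides are linear and continuous in A. On the group-like element T_{n,m} the slice is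
multiplication by the value of the counit, which is 1. -/
theorem sliceLeft_counit_comul (A : Toeplitz) :
    sliceLeft Toeplitz Toeplitz counit (comul A) = A := by
  have h : sliceLeft Toeplitz Toeplitz counit ∘L comulL = ContinuousLinearMap.id ℂ Toeplitz := by
    refine ContinuousLinearMap.ext_on dense_span_opT ?_
    rintro _ ⟨⟨n, m⟩, rfl⟩
    rw [ContinuousLinearMap.comp_apply, comulL_apply, comul_opT, sliceLeft_elemTensor, counit_opT,
      one_smul, ContinuousLinearMap.id_apply]
  exact DFunLike.congr_fun h A

theorem sliceRight_counit_comul (A : Toeplitz) :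
    sliceRight Toeplitz Toeplitz counit (comul A) = A := by
  have h : sliceRight Toeplitz Toeplitz counit ∘L comulL = ContinuousLinearMap.id ℂ Toeplitz := by
    refine ContinuousLinearMap.ext_on dense_span_opT ?_
    rintro _ ⟨⟨n, m⟩, rfl⟩
    rw [ContinuousLinearMap.comp_apply, comulL_apply, comul_opT, sliceRight_elemTensor, counit_opT,
      one_smul, ContinuousLinearMap.id_apply]
  exact DFunLike.congr_fun h A

end Counit

end ToeplitzQSG

end

theorem lemma6 :
    -- the compact operators lie in the Toeplitz algebra
    (∀ K : L2 ℕ →L[ℂ] L2 ℕ, IsCompactOperator K → K ∈ Toeplitz) ∧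
    ∃ ε : StrongDual ℂ Toeplitz,
      -- the functional with value 1 at all T_{n,m} extends, uniquely, to a continuous functional
      (∀ n m : ℕ, ε (opT n m) = 1) ∧
      (∀ ε' : StrongDual ℂ Toeplitz, (∀ n m : ℕ, ε' (opT n m) = 1) → ε' = ε) ∧
      -- it is the evaluation at 1 of the symbol map
      (∃ (Φ : (Toeplitz ⧸ compactIdeal) ≃ₗᵢ[ℂ] C(Circle, ℂ)) (γ : Toeplitz →⋆ₐ[ℂ] C(Circle, ℂ)),
        (∀ A : Toeplitz, γ A = Φ (Submodule.Quotient.mk A)) ∧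
        (∀ (n m : ℕ) (z : Circle), γ (opT n m) z = (z : ℂ) ^ ((m : ℤ) - (n : ℤ))) ∧
        (∀ A : Toeplitz, ε A = γ A 1)) ∧
      -- it is the unit of the Banach algebra of continuous functionals
      ‖ε‖ = 1 ∧
      (∀ ρ : StrongDual ℂ Toeplitz, ε * ρ = ρ ∧ ρ * ε = ρ) ∧
      -- it is a counit
      (∀ A : Toeplitz, sliceLeft Toeplitz Toeplitz ε (comul A) = A ∧
        sliceRight Toeplitz Toeplitz ε (comul A) = A) := by
  refine ⟨fun K hK => mem_toeplitz_of_isCompactOperator hK, counit, counit_opT,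
    fun ε' h => dual_ext fun n m => (h n m).trans (counit_opT n m).symm,
    ⟨symbolEquiv, symbol, fun A => (symbolEquiv_mk A).symm, symbol_opT, fun A => rfl⟩,
    norm_counit, fun ρ => ⟨counit_mul ρ, (mul_comm ρ counit).trans (counit_mul ρ)⟩,
    fun A => ⟨sliceLeft_counit_comul A, sliceRight_counit_comul A⟩⟩
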